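/- Let $d\ge 1$ be an integer and let $\alpha>0$, $s_*>0$ and $0<r<\infty$. For $f\in L^2(\mathbb R^d)$ write $\widehat f(\xi)=\int_{\mathbb R^d}e^{-ix\cdot\xi}f(x)\,dx$ (extended to $L^2$ by continuity), $\|f\|_{H^s}=\|(1+|\xi|^2)^{s/2}\widehat f(\xi)\|_{L^2(\mathbb R^d)}$, and $$e^{it(-\Delta)^{\alpha/2}}f(x)=(2\pi)^{-d}\int_{\mathbb R^d}e^{i(x\cdot\xi+t|\xi|^\alpha)}\,\widehat f(\xi)\,d\xi ,$$ the integral being taken pointwise if $\widehat f$ is integrable (in particular for Schwartz $f$) and as the $L^2$ Fourier multiplier operator with symbol $e^{it|\xi|^\alpha}$ in general. Let $B(0,1)$ be the open unit ball of $\mathbb R^d$. Suppose that for every $s\ge s_*$ there is a constant $C$ such that $$\Big\|\sup_{0<t\le 1}\big|e^{it(-\Delta)^{\alpha/2}}f\big|\Big\|_{L^2(B(0,1))}\le C\,\|f\|_{H^s}$$ for all Schwartz functions $f$ on $\mathbb R^d$. Let $(t_n)_{n\in\mathbb N}$ be a sequence of real numbers in $\ell^{r,\infty}(\mathbb N)$,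 that is, $\sup_{\delta>0}\delta^r\,\#\{n\in\mathbb N:|t_n|\ge\delta\}<\infty$. Then for every $$s\ \ge\ \min\Big\{\frac{r\alpha}{r\min\{\alpha,1\}+2s_*}\,s_*,\ s_*\Big\}$$ there is a constant $C'$ (depending on the sequence but not on $f$) such that $$\Big\|\sup_{n}\big|e^{it_n(-\Delta)^{\alpha/2}}f\big|\Big\|_{L^2(B(0,1))}\le C'\,\|f\|_{H^s}\qquad\text{for all } f\in H^s(\mathbb R^d).$$ -/

import Mathlib

open MeasureTheory SchwartzMap FourierTransform Metric Set
open scoped ENNReal NNReal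

noncomputable section

/-- The Euclidean space `ℝ^d`. -/
abbrev Rd (d : ℕ) : Type := EuclideanSpace ℝ (Fin d)

/-- The complex Hilbert space `L²(ℝ^d)`. -/
abbrev L2Rd (d : ℕ) : Type := Lp ℂ 2 (volume : Measure (Rd d))

/-- The Fourier transform of `f ∈ L²(ℝ^d)` in the normalization `f̂(ξ) = ∫ e^{-i x·ξ} f(x) dx`.
Mathlib's `𝓕` has the kernel `e^{-2π i x·η}`, hence the dilation; see `fourierHat_toLp_ae_eq`. -/
def fourierHat {d : ℕ} (f : L2Rd d) : Rd d → ℂ :=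
  fun ξ => (𝓕 f : L2Rd d) ((2 * Real.pi)⁻¹ • ξ)

/-- The inhomogeneous Sobolev norm `‖f‖_{H^s} = ‖(1 + |ξ|²)^{s/2} f̂(ξ)‖_{L²}`, with value `∞`
if `f` is not in `H^s(ℝ^d)`. For `s ≥ 0` the space `H^s(ℝ^d)` is a subspace of `L²(ℝ^d)`. -/
def sobolevENorm {d : ℕ} (s : ℝ) (f : L2Rd d) : ℝ≥0∞ :=
  eLpNorm (fun ξ : Rd d => (((1 + ‖ξ‖ ^ 2) ^ (s / 2) : ℝ) : ℂ) * fourierHat f ξ) 2 volume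

/-- The function
`e^{it(-Δ)^{α/2}} f (x) = (2π)^{-d} ∫ e^{i(x·ξ + t|ξ|^α)} f̂(ξ) dξ`,
given at every point `x` by the integral, for `f` with `f̂` integrable. -/
def schrodingerIntegral {d : ℕ} (α t : ℝ) (f : L2Rd d) (x : Rd d) : ℂ :=
  (((2 * Real.pi) ^ d : ℝ) : ℂ)⁻¹ *
    ∫ ξ : Rd d, Complex.exp (Complex.I * ((inner ℝ x ξ + t * ‖ξ‖ ^ α : ℝ) : ℂ)) * fourierHat f ξ

/-- The unimodular symbol of `e^{it(-Δ)^{α/2}}` in the frequency variable `η = ξ / (2π)` of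
Mathlib's Fourier transform. -/
def schrodingerSymbol {d : ℕ} (α t : ℝ) (η : Rd d) : ℂ :=
  Complex.exp (Complex.I * ((t * (2 * Real.pi * ‖η‖) ^ α : ℝ) : ℂ))

theorem norm_schrodingerSymbol {d : ℕ} (α t : ℝ) (η : Rd d) : ‖schrodingerSymbol α t η‖ = 1 := by
  unfold schrodingerSymbol
  rw [mul_comm]
  exact Complex.norm_exp_ofReal_mul_I _

theorem measurable_schrodingerSymbol {d : ℕ} (α t : ℝ) :
    Measurable (schrodingerSymbol (d := d) α t) := by
  unfold schrodingerSymbol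
  fun_prop

theorem memLp_schrodingerSymbol_mul {d : ℕ} (α t : ℝ) (g : L2Rd d) :
    MemLp (fun η : Rd d => schrodingerSymbol α t η * g η) 2 volume := by
  refine (Lp.memLp g).of_le
    ((measurable_schrodingerSymbol α t).aestronglyMeasurable.mul (Lp.aestronglyMeasurable g)) ?_
  filter_upwards with η
  rw [norm_mul, norm_schrodingerSymbol, one_mul]

/-- The operator `e^{it(-Δ)^{α/2}}` on `L²(ℝ^d)`: the Fourier multiplier `e^{it|ξ|^α}`. -/
def schrodingerOp {d : ℕ} (α t : ℝ) (f : L2Rd d) : L2Rd d :=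
  𝓕⁻ ((memLp_schrodingerSymbol_mul α t (𝓕 f : L2Rd d)).toLp _ : L2Rd d)

/-- On Schwartz functions `fourierHat` is the integral `∫ e^{-i x·ξ} f(x) dx`. -/
theorem fourierHat_toLp_ae_eq {d : ℕ} (f : 𝓢(Rd d, ℂ)) :
    fourierHat (f.toLp 2 volume) =ᵐ[volume]
      fun ξ => ∫ x : Rd d, Complex.exp (-Complex.I * ((inner ℝ x ξ : ℝ) : ℂ)) * f x := by
  have hc : (2 * Real.pi)⁻¹ ≠ 0 := by positivity
  have h := (Measure.quasiMeasurePreserving_smul (volume : Measure (Rd d)) hc).ae_eq_comp ((𝓕 f).coeFn_toLp 2 volume)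
  unfold fourierHat
  rw [SchwartzMap.toLp_fourier_eq]
  filter_upwards [h] with ξ hξ
  refine hξ.trans ?_
  simp only [Function.comp_apply, SchwartzMap.fourier_coe, Real.fourier_eq', smul_eq_mul]
  congr 1
  ext x
  congr 2
  rw [inner_smul_right]
  push_cast
  field_simp

/-- The inverse Fourier transform on `L²` is given by the integral on `L¹ ∩ L²`. -/
theorem fourierInv_ae_eq_of_integrable {d : ℕ} (g : L2Rd d) (hg : Integrable g volume) :
    (𝓕⁻ g : L2Rd d) =ᵐ[volume] 𝓕⁻ (g : Rd d → ℂ) := by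
  have hcont : Continuous (𝓕⁻ (g : Rd d → ℂ)) :=
    VectorFourier.fourierIntegral_continuous Real.continuous_fourierChar
      (continuous_inner (𝕜 := ℝ) (E := Rd d)).neg hg
  refine ae_eq_of_integral_contDiff_smul_eq
    ((Lp.memLp _).locallyIntegrable (by norm_num)) hcont.locallyIntegrable ?_
  intro φ hφ hφc
  have h₁ : HasCompactSupport (Complex.ofRealCLM ∘ φ) := hφc.comp_left rfl
  have h₂ : ContDiff ℝ ((⊤ : ℕ∞) : WithTop ℕ∞) (Complex.ofRealCLM ∘ φ) := by fun_prop
  set ψ : 𝓢(Rd d, ℂ) := h₁.toSchwartzMap h₂ with hψ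
  have hψa : ∀ x, ψ x = (φ x : ℂ) := fun x => rfl
  have e₁ : ∫ x, φ x • (𝓕⁻ g : L2Rd d) x = ((𝓕⁻ g : L2Rd d) : 𝓢'(Rd d, ℂ)) ψ := by
    rw [Lp.toTemperedDistribution_apply]
    simp [hψa]
  have e₂ : ((𝓕⁻ g : L2Rd d) : 𝓢'(Rd d, ℂ)) ψ = ∫ x, (𝓕⁻ ψ) x • g x := by
    rw [← Lp.fourierInv_toTemperedDistribution_eq, TemperedDistribution.fourierInv_apply,
      Lp.toTemperedDistribution_apply]
  rw [e₁, e₂]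
  have e₃ := VectorFourier.integral_fourierIntegral_smul_eq_flip (μ := (volume : Measure (Rd d)))
    (ν := (volume : Measure (Rd d))) (L := -innerₗ (Rd d)) (f := ψ) (g := g)
    Real.continuous_fourierChar (continuous_inner (𝕜 := ℝ) (E := Rd d)).neg
    ψ.integrable hg
  have hflip : (-innerₗ (Rd d)).flip = -innerₗ (Rd d) := by
    ext x y; simp [real_inner_comm]
  rw [hflip] at e₃
  rw [SchwartzMap.fourierInv_coe]
  refine e₃.trans ?_
  simp only [hψa, Complex.real_smul, smul_eq_mul]
  rfl

/-- The two definitions of `e^{it(-Δ)^{α/2}} f` agree almost everywhere if `f̂` is integrable. -/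
theorem schrodingerOp_ae_eq {d : ℕ} (α t : ℝ) (f : L2Rd d)
    (hf : Integrable (fourierHat f) volume) :
    schrodingerOp α t f =ᵐ[volume] schrodingerIntegral α t f := by
  have hc : (2 * Real.pi)⁻¹ ≠ 0 := by positivity
  have hF : Integrable (𝓕 f : L2Rd d) volume :=
    (integrable_comp_smul_iff volume (𝓕 f : L2Rd d) hc).1 hf
  have hG : Integrable (fun η : Rd d => schrodingerSymbol α t η * (𝓕 f : L2Rd d) η) volume := by
    refine hF.mono ((measurable_schrodingerSymbol α t).aestronglyMeasurable.mul
      (Lp.aestronglyMeasurable _)) ?_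
    filter_upwards with η
    rw [norm_mul, norm_schrodingerSymbol, one_mul]
  have hae := (memLp_schrodingerSymbol_mul α t (𝓕 f : L2Rd d)).coeFn_toLp
  refine (fourierInv_ae_eq_of_integrable _ (hG.congr hae.symm)).trans ?_
  filter_upwards with x
  rw [Real.fourierInv_eq']
  have hpi : 0 < 2 * Real.pi := by positivity
  have hs := Measure.integral_comp_smul (volume : Measure (Rd d))
    (fun η : Rd d => Complex.exp ((2 * Real.pi * inner ℝ η x : ℝ) * Complex.I) •
      (schrodingerSymbol α t η * (𝓕 f : L2Rd d) η)) (2 * Real.pi)⁻¹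
  have hcongr : ∫ v : Rd d, Complex.exp ((2 * Real.pi * inner ℝ v x : ℝ) * Complex.I) •
      ((memLp_schrodingerSymbol_mul α t (𝓕 f : L2Rd d)).toLp _ : L2Rd d) v =
      ∫ v : Rd d, Complex.exp ((2 * Real.pi * inner ℝ v x : ℝ) * Complex.I) •
      (schrodingerSymbol α t v * (𝓕 f : L2Rd d) v) := by
    refine integral_congr_ae ?_
    filter_upwards [hae] with v hv
    rw [hv]
  rw [hcongr]
  have hI : ∫ ξ : Rd d, Complex.exp (Complex.I * ((inner ℝ x ξ + t * ‖ξ‖ ^ α : ℝ) : ℂ)) *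
      fourierHat f ξ = ((2 * Real.pi) ^ d : ℝ) •
      ∫ v : Rd d, Complex.exp ((2 * Real.pi * inner ℝ v x : ℝ) * Complex.I) •
      (schrodingerSymbol α t v * (𝓕 f : L2Rd d) v) := by
    have habs : |((2 * Real.pi)⁻¹ ^ Module.finrank ℝ (Rd d))⁻¹| = (2 * Real.pi) ^ d := by
      rw [abs_of_pos (by positivity), finrank_euclideanSpace_fin, inv_pow, inv_inv]
    rw [habs] at hs
    rw [← hs]
    congr 1
    ext ξ
    simp only [smul_eq_mul, schrodingerSymbol, fourierHat]
    rw [← mul_assoc, ← Complex.exp_add]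
    congr 2
    have hn : 2 * Real.pi * ‖(2 * Real.pi)⁻¹ • ξ‖ = ‖ξ‖ := by
      rw [norm_smul, Real.norm_of_nonneg (by positivity)]
      field_simp
    have hi : 2 * Real.pi * inner ℝ ((2 * Real.pi)⁻¹ • ξ) x = inner ℝ x ξ := by
      rw [real_inner_smul_left, real_inner_comm]
      field_simp
    rw [hn, hi]
    push_cast
    ring
  unfold schrodingerIntegral
  rw [hI, Complex.real_smul, ← mul_assoc, inv_mul_cancel₀, one_mul]
  exact_mod_cast (by positivity : (2 * Real.pi) ^ d ≠ 0)

/-- The local maximal estimate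
`‖sup_{0 < t ≤ 1} |e^{it(-Δ)^{α/2}} f|‖_{L²(B(0,1))} ≤ C ‖f‖_{H^s}`. The supremum is over an
uncountable set, so the estimate is an a priori one: it is for Schwartz functions `f`, and
`e^{it(-Δ)^{α/2}} f (x)` is given at every point by the integral formula. -/
def LocalMaximalEstimate (d : ℕ) (α s : ℝ) : Prop :=
  ∃ C : ℝ≥0, ∀ f : 𝓢(Rd d, ℂ),
    eLpNorm (fun x : Rd d =>
        ⨆ t ∈ Ioc (0 : ℝ) 1, ‖schrodingerIntegral α t (f.toLp 2 volume) x‖ₑ)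
      2 (volume.restrict (ball 0 1)) ≤ C * sobolevENorm s (f.toLp 2 volume)

/-- The sequential maximal estimate
`‖sup_n |e^{it_n(-Δ)^{α/2}} f|‖_{L²(B(0,1))} ≤ C ‖f‖_{H^s}` for all `f ∈ H^s(ℝ^d)`, `s ≥ 0`. -/
def SequentialMaximalEstimate (d : ℕ) (α : ℝ) (t : ℕ → ℝ) (s : ℝ) : Prop :=
  ∃ C : ℝ≥0, ∀ f : L2Rd d, sobolevENorm s f < ∞ →
    eLpNorm (fun x : Rd d => ⨆ n : ℕ, ‖schrodingerOp α (t n) f x‖ₑ)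
      2 (volume.restrict (ball 0 1)) ≤ C * sobolevENorm s f

/-- The weak space `ℓ^{r,∞}(ℕ)`: `sup_{δ > 0} δ^r #{n : |t_n| ≥ δ} < ∞`. -/
def MemWeakEll (r : ℝ) (t : ℕ → ℝ) : Prop :=
  (⨆ δ ∈ Ioi (0 : ℝ), ENNReal.ofReal (δ ^ r) * (({n : ℕ | δ ≤ |t n|}.encard : ℕ∞) : ℝ≥0∞)) < ∞

end

/-!
The estimate is proved in the variable `η = ξ / (2π)` of Mathlib's Fourier transform, for the
evolution `evol α t g` of a frequency profile `g = 𝓕 f`. Squared `L²` norms are written as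
`ℝ≥0∞`-valued integrals, so that only one-sided bounds on integrals have to be handled.

*Localization to one frequency.* Write `a = sStar / min α 1`. The core is the global bound
`∫ (sup_{0 < |t| ≤ T M^{-α}} |e^{it(-Δ)^{α/2}} f|)² ≤ C T^{2a} ‖f‖²`, `T ≥ 1`, for `f` with
frequencies comparable to `M` (`IsLocalBound.exists_global`, `IsLocalBound.exists_shell`). With
`R = T^{1 / min α 1}`, rescaling the hypothesis gives such a bound with constant `R^{2 sStar}` on
every ball of radius `R / M`. A wave with frequencies comparable to `M` travels at most about
`R / M` in the times considered, so the bound on a ball should only see the part of `f` near that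
ball. This is made precise without kernel estimates: multiplication by a coordinate commutes with
the evolution up to terms of the same form (`evolFun_mul_fourier_inner_smul`), so by induction on
the number of coordinates the local bound holds with the weight `∏ (1 + ((x_j - y_j) M / R)²)⁻¹`
on the right (`IsLocalBound.exists_weighted`). That weight is integrable, and integrating over the
centre `y` gives the global bound.

*Summation over frequencies.* For `σ = r α sStar / (r min α 1 + 2 sStar)` put `q = 2σ / r`, so that
`a (α - q) = σ`. For a nonzero time `t n` let `2^N` be the frequency with `|t n| ≈ 2^{-N q}`, and
split `g` into dyadic shells `k < N` and the tail of frequencies at least about `2^N`.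
* The tails are summed over `n` in `ℓ²`, with no maximal estimate at all: a frequency of size `2^k`
  is counted once for each `n` with `|t n| ≳ 2^{-k q}`, hence at most `K 2^{k q r} = K 2^{2kσ}`
  times by the weak `ℓ^r` hypothesis (`tsum_tail_energy_le`).
* A shell `k` with `|t n| ≤ 2^{-kα}` is controlled by the shell bound with `T = 1`, and the gain
  `2^{-kσ}` against the `H^σ` norm makes the sum over `k` converge
  (`IsLocalBound.exists_short_time`).
* A shell `k` with `2^{-kα} < |t n|` and `k = N - 1 - i` is controlled by the shell bound with
  `T = 2^{kα - (k + i) q}`, whose constant `T^{2a}` is `2^{2kσ}` times the geometric gain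
  `2^{-2 i q a}` (`IsLocalBound.exists_long_time`).

For `s ≥ sStar` the hypothesis itself handles the times with `|t n| ≤ 1`, and the remaining times
are finitely many (`IsLocalBound.exists_sequential_self`). The hypothesis concerns Schwartz
functions and times in `(0, 1]`: negative times are reached by conjugation (`evolFun_neg_conj`),
general `L²` profiles by density, which is where the countability of the set of times enters
(`lintegral_iSup_evol_le_of_tendsto`).
-/

noncomputable section

/-! ### Pointwise evolution of a frequency profile -/

/-- The value at every point of the evolution `e^{it(-Δ)^{α/2}} f` with frequency profile `G = 𝓕 f`,
in the frequency variable `η = ξ / (2π)`. It is meaningful for integrable `G`. -/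
def evolFun {d : ℕ} (α t : ℝ) (G : Rd d → ℂ) : Rd d → ℂ :=
  𝓕⁻ (fun ξ => schrodingerSymbol α t ξ * G ξ)

/-- The maximal function `sup_{t ∈ Θ} |e^{it(-Δ)^{α/2}} f|` over an arbitrary set `Θ` of times, for
the frequency profile `G = 𝓕 f`. -/
def maxFun {d : ℕ} (α : ℝ) (Θ : Set ℝ) (G : Rd d → ℂ) (x : Rd d) : ℝ≥0∞ :=
  ⨆ t ∈ Θ, ‖evolFun α t G x‖ₑ

section Pointwise
variable {d : ℕ} {α t : ℝ} {G H : Rd d → ℂ}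

theorem integrable_schrodingerSymbol_mul (α t : ℝ) (hG : Integrable G) :
    Integrable (fun ξ => schrodingerSymbol α t ξ * G ξ) := by
  refine hG.mono ((measurable_schrodingerSymbol α t).aestronglyMeasurable.mul
    hG.aestronglyMeasurable) ?_
  filter_upwards with η
  rw [norm_mul, norm_schrodingerSymbol, one_mul]

theorem evolFun_apply (α t : ℝ) (G : Rd d → ℂ) (x : Rd d) :
    evolFun α t G x = ∫ ξ : Rd d, Complex.exp ((2 * Real.pi * inner ℝ ξ x : ℝ) * Complex.I) *
      (schrodingerSymbol α t ξ * G ξ) := by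
  unfold evolFun
  rw [Real.fourierInv_eq']
  rfl

theorem continuous_evolFun (α t : ℝ) (hG : Integrable G) : Continuous (evolFun α t G) :=
  VectorFourier.fourierIntegral_continuous Real.continuous_fourierChar
      (continuous_inner (𝕜 := ℝ) (E := Rd d)).neg (integrable_schrodingerSymbol_mul α t hG)

/-- The maximal function is lower semicontinuous, hence measurable even for uncountable `Θ`. -/
theorem measurable_maxFun (α : ℝ) (Θ : Set ℝ) (hG : Integrable G) :
    Measurable (maxFun α Θ G) :=
  (lowerSemicontinuous_biSup fun t _ =>
    (continuous_evolFun α t hG).enorm.lowerSemicontinuous).measurable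

theorem enorm_evolFun_le_maxFun {Θ : Set ℝ} (ht : t ∈ Θ) (x : Rd d) :
    ‖evolFun α t G x‖ₑ ≤ maxFun α Θ G x :=
  le_iSup₂_of_le t ht le_rfl

theorem maxFun_le_iff {Θ : Set ℝ} {x : Rd d} {c : ℝ≥0∞} :
    maxFun α Θ G x ≤ c ↔ ∀ t ∈ Θ, ‖evolFun α t G x‖ₑ ≤ c :=
  iSup₂_le_iff

theorem maxFun_mono {Θ Θ' : Set ℝ} (h : Θ ⊆ Θ') (x : Rd d) :
    maxFun α Θ G x ≤ maxFun α Θ' G x :=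
  biSup_mono h

theorem evolFun_add (hG : Integrable G) (hH : Integrable H) (x : Rd d) :
    evolFun α t (fun ξ => G ξ + H ξ) x = evolFun α t G x + evolFun α t H x := by
  have key : ∀ {K : Rd d → ℂ}, Integrable K → Integrable (fun ξ : Rd d =>
      Complex.exp ((2 * Real.pi * inner ℝ ξ x : ℝ) * Complex.I) *
        (schrodingerSymbol α t ξ * K ξ)) := by
    intro K hK
    refine (integrable_schrodingerSymbol_mul α t hK).mono ?_ ?_
    · exact (by fun_prop : Continuous fun ξ : Rd d =>
        Complex.exp ((2 * Real.pi * inner ℝ ξ x : ℝ) * Complex.I)).aestronglyMeasurable.mul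
          (integrable_schrodingerSymbol_mul α t hK).aestronglyMeasurable
    · filter_upwards with ξ
      rw [norm_mul, Complex.norm_exp_ofReal_mul_I, one_mul]
  rw [evolFun_apply, evolFun_apply, evolFun_apply, ← integral_add (key hG) (key hH)]
  congr 1; ext ξ; ring

theorem evolFun_const_mul (c : ℂ) (x : Rd d) :
    evolFun α t (fun ξ => c * G ξ) x = c * evolFun α t G x := by
  rw [evolFun_apply, evolFun_apply, ← integral_const_mul]
  congr 1; ext ξ; ring

/-- Time reversal corresponds to complex conjugation of `f`; on the profile this is conjugation
together with a reflection, which has been moved to the point `x`. -/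
theorem evolFun_neg_conj (x : Rd d) :
    evolFun α (-t) G x = starRingEnd ℂ (evolFun α t (fun ξ => starRingEnd ℂ (G ξ)) (-x)) := by
  rw [evolFun_apply, evolFun_apply, ← integral_conj]
  congr 1; ext ξ
  simp only [schrodingerSymbol, map_mul, ← Complex.exp_conj, Complex.conj_ofReal, Complex.conj_I,
    Complex.conj_conj]
  congr 2
  · rw [inner_neg_right]; push_cast; ring_nf
  · push_cast; ring_nf

/-- Dilation and translation covariance: the evolution of `G` on the ball of radius `ρ` about `y` is
the evolution of a dilated and modulated profile on the unit ball, at the time `t ρ ^ (-α)`. -/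
theorem evolFun_add_smul {ρ : ℝ} (hρ : 0 < ρ) (y x : Rd d) :
    evolFun α t G (y + ρ • x) = ((ρ ^ d : ℝ) : ℂ)⁻¹ * evolFun α (t * (ρ ^ α)⁻¹)
      (fun η => Complex.exp ((2 * Real.pi * inner ℝ (ρ⁻¹ • η) y : ℝ) * Complex.I) *
        G (ρ⁻¹ • η)) x := by
  rw [evolFun_apply, evolFun_apply]
  have hs := Measure.integral_comp_smul (volume : Measure (Rd d))
    (fun ξ : Rd d => Complex.exp ((2 * Real.pi * inner ℝ ξ (y + ρ • x) : ℝ) * Complex.I) *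
      (schrodingerSymbol α t ξ * G ξ)) ρ⁻¹
  have habs : |(ρ⁻¹ ^ Module.finrank ℝ (Rd d))⁻¹| = ρ ^ d := by
    rw [abs_of_pos (by positivity), finrank_euclideanSpace_fin, inv_pow, inv_inv]
  rw [habs, Complex.real_smul] at hs
  rw [eq_inv_mul_iff_mul_eq₀ (by exact_mod_cast (by positivity : ρ ^ d ≠ 0)), ← hs]
  congr 1; ext η
  have h1 : Complex.exp ((2 * Real.pi * inner ℝ (ρ⁻¹ • η) (y + ρ • x) : ℝ) * Complex.I) =
      Complex.exp ((2 * Real.pi * inner ℝ η x : ℝ) * Complex.I) *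
      Complex.exp ((2 * Real.pi * inner ℝ (ρ⁻¹ • η) y : ℝ) * Complex.I) := by
    rw [← Complex.exp_add, inner_add_right, real_inner_smul_left η (ρ • x), real_inner_smul_right,
      inv_mul_cancel_left₀ hρ.ne']
    congr 1; push_cast; ring
  have h2 : schrodingerSymbol α t (ρ⁻¹ • η) = schrodingerSymbol α (t * (ρ ^ α)⁻¹) η := by
    unfold schrodingerSymbol
    rw [norm_smul, Real.norm_of_nonneg (by positivity),
      show 2 * Real.pi * (ρ⁻¹ * ‖η‖) = ρ⁻¹ * (2 * Real.pi * ‖η‖) by ring,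
      Real.mul_rpow (by positivity) (by positivity), Real.inv_rpow hρ.le]
    congr 3; ring
  rw [h1, h2]; ring

/-- Dilation covariance with `ρ = 2π` is the passage from the frequency `ξ` to `η = ξ / (2π)`. -/
theorem schrodingerIntegral_toLp (f : 𝓢(Rd d, ℂ)) (x : Rd d) :
    schrodingerIntegral α t (f.toLp 2 volume) x = evolFun α t (𝓕 f : 𝓢(Rd d, ℂ)) x := by
  have hc : (2 * Real.pi)⁻¹ ≠ 0 := by positivity
  have h := (Measure.quasiMeasurePreserving_smul (volume : Measure (Rd d)) hc).ae_eq_comp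
    ((𝓕 f).coeFn_toLp 2 volume)
  have h' : fourierHat (f.toLp 2 volume) =ᵐ[volume] fun ξ => (𝓕 f) ((2 * Real.pi)⁻¹ • ξ) := by
    unfold fourierHat
    rw [SchwartzMap.toLp_fourier_eq]
    exact h
  have e := evolFun_add_smul (α := α) (t := t) (G := (𝓕 f : 𝓢(Rd d, ℂ))) (ρ := 2 * Real.pi)
    (by positivity) 0 ((2 * Real.pi)⁻¹ • x)
  rw [zero_add, smul_smul, mul_inv_cancel₀ (by positivity), one_smul] at e
  rw [e, schrodingerIntegral, evolFun_apply]
  congr 1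
  refine integral_congr_ae ?_
  filter_upwards [h'] with ξ hξ
  rw [hξ, inner_zero_right, mul_zero, Complex.ofReal_zero, zero_mul, Complex.exp_zero, one_mul,
    ← mul_assoc]
  congr 1
  rw [schrodingerSymbol, ← Complex.exp_add]
  congr 1
  have e3 : (2 * Real.pi * ‖ξ‖) ^ α = (2 * Real.pi) ^ α * ‖ξ‖ ^ α :=
    Real.mul_rpow (by positivity) (by positivity)
  have e4 : (2 * Real.pi) ^ α ≠ 0 := by positivity
  rw [e3, real_inner_smul_right, real_inner_comm ξ x,
    show t * ((2 * Real.pi) ^ α)⁻¹ * ((2 * Real.pi) ^ α * ‖ξ‖ ^ α) = t * ‖ξ‖ ^ α by field_simp,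
    show 2 * Real.pi * ((2 * Real.pi)⁻¹ * inner ℝ ξ x) = inner ℝ ξ x by field_simp]
  push_cast; ring

end Pointwise

section Integrals
variable {d : ℕ}

theorem lintegral_comp_smul_inv (F : Rd d → ℝ≥0∞) {ρ : ℝ} (hρ : 0 < ρ) :
    ∫⁻ x, F (ρ⁻¹ • x) = ENNReal.ofReal (ρ ^ d) * ∫⁻ x, F x := by
  have h := (MeasurableEquiv.smul₀ (α := Rd d) ρ⁻¹
    (inv_ne_zero hρ.ne')).measurableEmbedding.lintegral_map (μ := (volume : Measure (Rd d))) F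
  have h2 := Measure.map_addHaar_smul (volume : Measure (Rd d)) (inv_ne_zero hρ.ne')
  rw [MeasurableEquiv.coe_smul₀, h2, lintegral_smul_measure] at h
  rw [← h, finrank_euclideanSpace_fin, inv_pow, inv_inv, abs_of_pos (by positivity)]
  rfl

theorem eLpNorm_two_sq {X ε : Type*} [MeasurableSpace X] [ENorm ε] (μ : Measure X) (F : X → ε) :
    eLpNorm F 2 μ ^ 2 = ∫⁻ x, ‖F x‖ₑ ^ 2 ∂μ := by
  have := eLpNorm_nnreal_pow_eq_lintegral (μ := μ) (f := F) (p := 2) (by norm_num)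
  simpa using this

theorem sobolevENorm_sq (s : ℝ) (f : L2Rd d) :
    sobolevENorm s f ^ 2 = ENNReal.ofReal ((2 * Real.pi) ^ d) *
      ∫⁻ η : Rd d, ENNReal.ofReal ((1 + (2 * Real.pi * ‖η‖) ^ 2) ^ s) *
        ‖(𝓕 f : L2Rd d) η‖ₑ ^ 2 := by
  have hp : 0 < 2 * Real.pi := by positivity
  rw [sobolevENorm, eLpNorm_two_sq, ← lintegral_comp_smul_inv _ hp]
  congr 1; ext ξ
  have hn : 2 * Real.pi * ‖(2 * Real.pi)⁻¹ • ξ‖ = ‖ξ‖ := by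
    rw [norm_smul, Real.norm_of_nonneg (by positivity)]
    field_simp
  rw [hn, enorm_mul, mul_pow, fourierHat]
  congr 1
  rw [← ofReal_norm, ← ENNReal.ofReal_pow (norm_nonneg _), Complex.norm_real,
    Real.norm_of_nonneg (by positivity), ← Real.rpow_natCast, ← Real.rpow_mul (by positivity)]
  congr 2; push_cast; ring

theorem ENNReal.add_sq_le_two_mul (a b : ℝ≥0∞) : (a + b) ^ 2 ≤ 2 * (a ^ 2 + b ^ 2) := by
  have := ENNReal.rpow_add_le_mul_rpow_add_rpow a b (p := 2) (by norm_num)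
  norm_num at this
  simpa using this

theorem setLIntegral_ball_comp_neg (F : Rd d → ℝ≥0∞) (r : ℝ) :
    ∫⁻ x in ball 0 r, F (-x) = ∫⁻ x in ball 0 r, F x := by
  have h := (Measure.measurePreserving_neg (volume : Measure (Rd d))).setLIntegral_comp_preimage_emb
    (MeasurableEquiv.neg (Rd d)).measurableEmbedding F (ball 0 r)
  have h2 : (Neg.neg : Rd d → Rd d) ⁻¹' ball 0 r = ball 0 r := by
    ext x; simp
  rw [h2] at h
  exact h

/-- The squared Sobolev weight in the frequency variable `η = ξ / (2π)`. -/
def sobolevWeight (s : ℝ) (η : Rd d) : ℝ := (1 + (2 * Real.pi * ‖η‖) ^ 2) ^ s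

/-- The local maximal estimate in terms of frequency profiles, extended to nonzero times of either
sign. Time `0` stays excluded: the hypothesis says nothing about it. -/
theorem LocalMaximalEstimate.lintegral_le {α s : ℝ} (h : LocalMaximalEstimate d α s) :
    ∃ C : ℝ≥0, ∀ G : 𝓢(Rd d, ℂ),
      ∫⁻ x in ball 0 1, maxFun α {t | t ≠ 0 ∧ |t| ≤ 1} G x ^ 2 ≤
        C * ∫⁻ η, ENNReal.ofReal (sobolevWeight s η) * ‖G η‖ₑ ^ 2 := by
  obtain ⟨C, hC⟩ := h
  -- the constants in front account for `(2π)^d` in the change of frequency variable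
  have key : ∀ G : 𝓢(Rd d, ℂ), ∫⁻ x in ball 0 1, maxFun α (Ioc 0 1) G x ^ 2 ≤
      (C ^ 2 * ((2 * Real.pi) ^ d).toNNReal : ℝ≥0) *
        ∫⁻ η, ENNReal.ofReal (sobolevWeight s η) * ‖G η‖ₑ ^ 2 := by
    intro G
    have h1 := pow_le_pow_left' (hC (𝓕⁻ G)) 2
    have hF : 𝓕 (𝓕⁻ G) = G := FourierTransform.fourier_fourierInv_eq G
    rw [eLpNorm_two_sq, mul_pow, sobolevENorm_sq, SchwartzMap.toLp_fourier_eq, hF] at h1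
    refine le_trans (le_of_eq ?_) (h1.trans (le_of_eq ?_))
    · refine lintegral_congr fun x => ?_
      simp only [enorm_eq_self, maxFun, schrodingerIntegral_toLp, hF]
    · rw [← mul_assoc, ENNReal.coe_mul, ENNReal.coe_pow]
      congr 1
      refine lintegral_congr_ae ?_
      filter_upwards [G.coeFn_toLp 2 volume] with η hη
      rw [hη, sobolevWeight]
  refine ⟨4 * (C ^ 2 * ((2 * Real.pi) ^ d).toNNReal), fun G => ?_⟩
  -- the profile whose evolution at the negative times is that of `G` at positive times, conjugated
  set G' : 𝓢(Rd d, ℂ) := G.postcompCLM (𝕜 := ℝ) (Complex.conjCLE : ℂ →L[ℝ] ℂ) with hG'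
  have hG'a : ∀ ξ, G' ξ = starRingEnd ℂ (G ξ) := fun ξ => rfl
  have hG'f : (G' : Rd d → ℂ) = fun ξ => starRingEnd ℂ (G ξ) := rfl
  have hle : ∀ x, maxFun α {t | t ≠ 0 ∧ |t| ≤ 1} G x ^ 2 ≤
      2 * (maxFun α (Ioc 0 1) G x ^ 2 + maxFun α (Ioc 0 1) G' (-x) ^ 2) := by
    intro x
    refine le_trans (pow_le_pow_left' ?_ 2) (ENNReal.add_sq_le_two_mul _ _)
    rw [maxFun_le_iff]
    rintro t ⟨ht0, ht⟩
    rcases lt_or_gt_of_ne ht0 with h | h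
    · refine le_add_left ?_
      have e := evolFun_neg_conj (α := α) (t := -t) (G := G) x
      rw [neg_neg] at e
      rw [e, ← hG'f, RCLike.enorm_conj]
      exact enorm_evolFun_le_maxFun (Θ := Ioc 0 1) ⟨by linarith, by rwa [abs_of_neg h] at ht⟩ _
    · exact le_add_right (enorm_evolFun_le_maxFun (Θ := Ioc 0 1) ⟨h, by rwa [abs_of_pos h] at ht⟩ _)
  have hGG : ∫⁻ η, ENNReal.ofReal (sobolevWeight s η) * ‖G' η‖ₑ ^ 2 =
      ∫⁻ η, ENNReal.ofReal (sobolevWeight s η) * ‖G η‖ₑ ^ 2 := by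
    simp only [hG'a, RCLike.enorm_conj]
  have m1 : Measurable fun x => maxFun α (Ioc 0 1) G x ^ 2 :=
    (measurable_maxFun α _ G.integrable).pow_const 2
  have e2 := setLIntegral_ball_comp_neg (fun x => maxFun α (Ioc 0 1) G' x ^ 2) 1
  calc _ ≤ ∫⁻ x in ball 0 1, 2 * (maxFun α (Ioc 0 1) G x ^ 2 + maxFun α (Ioc 0 1) G' (-x) ^ 2) :=
        lintegral_mono hle
    _ = 2 * ((∫⁻ x in ball 0 1, maxFun α (Ioc 0 1) G x ^ 2) +
          ∫⁻ x in ball 0 1, maxFun α (Ioc 0 1) G' x ^ 2) := by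
        rw [lintegral_const_mul' _ _ (by norm_num), lintegral_add_left m1, e2]
    _ ≤ _ := by
        refine (mul_le_mul_right (add_le_add (key G) (key G')) 2).trans (le_of_eq ?_)
        rw [hGG]; push_cast; ring

end Integrals

/-! ### The evolution on square integrable profiles -/

section Evolution
open Filter Topology
variable {d : ℕ} {α t : ℝ}

/-- The Schrödinger evolution on `L²`, as a function of the frequency profile `g = 𝓕 f`. -/
def evol (α t : ℝ) (g : L2Rd d) : L2Rd d :=
  𝓕⁻ ((memLp_schrodingerSymbol_mul α t g).toLp _ : L2Rd d)

theorem schrodingerOp_eq_evol (f : L2Rd d) : schrodingerOp α t f = evol α t (𝓕 f) := rfl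

theorem evol_add (g h : L2Rd d) : evol α t (g + h) = evol α t g + evol α t h := by
  unfold evol
  rw [← FourierTransform.fourierInv_add, ← MemLp.toLp_add]
  congr 1
  refine (MemLp.toLp_eq_toLp_iff _ _).2 ?_
  filter_upwards [Lp.coeFn_add g h] with η hη
  rw [hη, Pi.add_apply, Pi.add_apply]
  exact mul_add _ _ _

theorem norm_evol (g : L2Rd d) : ‖evol α t g‖ = ‖g‖ := by
  have h1 : ‖evol α t g‖ = ‖((memLp_schrodingerSymbol_mul α t g).toLp _ : L2Rd d)‖ := by
    rw [← Lp.norm_fourier_eq (evol α t g), evol, FourierTransform.fourier_fourierInv_eq]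
  rw [h1, Lp.norm_toLp, Lp.norm_def]
  congr 1
  refine eLpNorm_congr_norm_ae ?_
  filter_upwards with η
  rw [norm_mul, norm_schrodingerSymbol, one_mul]

theorem lintegral_enorm_sq_eq (g : L2Rd d) : ∫⁻ x, ‖g x‖ₑ ^ 2 = ‖g‖ₑ ^ 2 := by
  rw [← eLpNorm_two_sq, Lp.enorm_def]

theorem lintegral_enorm_evol_sq (g : L2Rd d) :
    ∫⁻ x, ‖evol α t g x‖ₑ ^ 2 = ∫⁻ x, ‖g x‖ₑ ^ 2 := by
  rw [lintegral_enorm_sq_eq, lintegral_enorm_sq_eq, ← ofReal_norm, norm_evol, ofReal_norm]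

theorem evol_toLp_ae_eq (G : 𝓢(Rd d, ℂ)) :
    evol α t (G.toLp 2 volume) =ᵐ[volume] evolFun α t G := by
  have hae := (memLp_schrodingerSymbol_mul α t (G.toLp 2 volume)).coeFn_toLp
  have hae2 : ((memLp_schrodingerSymbol_mul α t (G.toLp 2 volume)).toLp _ : L2Rd d)
      =ᵐ[volume] fun η => schrodingerSymbol α t η * G η := by
    refine hae.trans ?_
    filter_upwards [G.coeFn_toLp 2 volume] with η hη
    rw [hη]
  have hint := integrable_schrodingerSymbol_mul (α := α) (t := t) (G.integrable (μ := volume))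
  refine (fourierInv_ae_eq_of_integrable _ (hint.congr hae2.symm)).trans ?_
  filter_upwards with x
  rw [evolFun, Real.fourierInv_eq', Real.fourierInv_eq']
  refine integral_congr_ae ?_
  filter_upwards [hae2] with v hv
  rw [hv]

/-- An a priori maximal estimate along Schwartz profiles passes to their limits in `L²`, for
countably many times. For finitely many times this is the triangle inequality, as each evolution
is an isometry; monotone convergence does the rest. -/
theorem lintegral_iSup_evol_le_of_tendsto {B : Set (Rd d)} {g : L2Rd d} {G : ℕ → 𝓢(Rd d, ℂ)}
    (hG : Tendsto (fun k => ((G k).toLp 2 volume : L2Rd d)) atTop (𝓝 g)) {Θ : Set ℝ} {τ : ℕ → ℝ}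
    {S : Set ℕ} (hS : ∀ n ∈ S, τ n ∈ Θ) {b : ℕ → ℝ≥0∞} {c : ℝ≥0∞} (hb : Tendsto b atTop (𝓝 c))
    (h : ∀ k, ∫⁻ x in B, maxFun α Θ (G k) x ^ 2 ≤ b k) :
    ∫⁻ x in B, (⨆ n ∈ S, ‖evol α (τ n) g x‖ₑ) ^ 2 ≤ c := by
  set μ := (volume : Measure (Rd d)).restrict B
  have hsm : ∀ (g : L2Rd d) (n : ℕ), Measurable fun x => ‖evol α (τ n) g x‖ₑ := fun g n =>
    (Lp.stronglyMeasurable _).measurable.enorm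
  set F : ℕ → Rd d → ℝ≥0∞ := fun N x => ⨆ n ∈ {n ∈ S | n < N}, ‖evol α (τ n) g x‖ₑ with hF
  have hFm : ∀ N, Measurable (F N) := fun N =>
    Measurable.biSup _ (to_countable _) fun n _ => hsm g n
  have hfin : ∀ N, ∫⁻ x, F N x ^ 2 ∂μ ≤ c := by
    intro N
    have hk : ∀ k, eLpNorm (F N) 2 μ ≤ b k ^ (1 / 2 : ℝ) + N * ‖g - (G k).toLp 2 volume‖ₑ := by
      intro k
      have hpt : ∀ᵐ x ∂μ, F N x ≤ maxFun α Θ (G k) x +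
          ∑ n ∈ Finset.range N, ‖evol α (τ n) (g - (G k).toLp 2 volume) x‖ₑ := by
        refine ae_restrict_of_ae ?_
        have h1 := ae_all_iff.2 fun n => evol_toLp_ae_eq (α := α) (t := τ n) (G k)
        have h2 := ae_all_iff.2 fun n => Lp.coeFn_add (evol α (τ n) (g - (G k).toLp 2 volume))
          (evol α (τ n) ((G k).toLp 2 volume))
        filter_upwards [h1, h2] with x hx1 hx2
        refine iSup₂_le fun n hn => ?_
        have e : evol α (τ n) g x = evol α (τ n) (g - (G k).toLp 2 volume) x +
            evolFun α (τ n) (G k) x := by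
          rw [← hx1 n, ← Pi.add_apply, ← hx2 n, ← evol_add, sub_add_cancel]
        rw [e, add_comm]
        refine (enorm_add_le _ _).trans (add_le_add (enorm_evolFun_le_maxFun (hS n hn.1) x) ?_)
        exact Finset.single_le_sum (f := fun n => ‖evol α (τ n) (g - (G k).toLp 2 volume) x‖ₑ)
          (fun _ _ => zero_le) (Finset.mem_range.2 hn.2)
      have m1 : AEStronglyMeasurable (maxFun α Θ (G k)) μ :=
        (measurable_maxFun α Θ (G k).integrable).aestronglyMeasurable
      have m2 : ∀ n, AEStronglyMeasurable
          (fun x => ‖evol α (τ n) (g - (G k).toLp 2 volume) x‖ₑ) μ := fun n =>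
        (hsm _ n).aestronglyMeasurable
      calc eLpNorm (F N) 2 μ ≤ eLpNorm (maxFun α Θ (G k) +
            ∑ n ∈ Finset.range N, fun x => ‖evol α (τ n) (g - (G k).toLp 2 volume) x‖ₑ) 2 μ := by
            refine eLpNorm_mono_enorm_ae ?_
            filter_upwards [hpt] with x hx
            simpa using hx
        _ ≤ eLpNorm (maxFun α Θ (G k)) 2 μ + eLpNorm (∑ n ∈ Finset.range N,
              fun x => ‖evol α (τ n) (g - (G k).toLp 2 volume) x‖ₑ) 2 μ :=
            eLpNorm_add_le m1 (Finset.aestronglyMeasurable_sum _ fun n _ => m2 n) (by norm_num)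
        _ ≤ b k ^ (1 / 2 : ℝ) + ∑ n ∈ Finset.range N, ‖g - (G k).toLp 2 volume‖ₑ := by
            refine add_le_add ?_ ((eLpNorm_sum_le (fun n _ => m2 n) (by norm_num)).trans
              (Finset.sum_le_sum fun n _ => ?_))
            · have := eLpNorm_two_sq μ (maxFun α Θ (G k))
              rw [one_div, ENNReal.le_rpow_inv_iff two_pos, ENNReal.rpow_two, this]
              exact h k
            · rw [eLpNorm_enorm]
              refine (eLpNorm_mono_measure _ Measure.restrict_le_self).trans (le_of_eq ?_)
              rw [← Lp.enorm_def, ← ofReal_norm, norm_evol, ofReal_norm]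
        _ = _ := by simp
    have hlim : Tendsto (fun k => b k ^ (1 / 2 : ℝ) + N * ‖g - (G k).toLp 2 volume‖ₑ) atTop
        (𝓝 (c ^ (1 / 2 : ℝ) + N * 0)) := by
      refine (hb.ennrpow_const _).add (ENNReal.Tendsto.const_mul ?_ (Or.inr (by simp)))
      have := (tendsto_const_nhds (x := g)).sub hG
      rw [sub_self] at this
      simpa using this.enorm
    have := ge_of_tendsto' hlim hk
    rw [mul_zero, add_zero] at this
    have h2 := pow_le_pow_left' this 2
    rw [eLpNorm_two_sq, ← ENNReal.rpow_natCast, ← ENNReal.rpow_mul] at h2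
    simpa using h2
  have hmono : Monotone F := fun N N' hN x => biSup_mono fun n hn => ⟨hn.1, hn.2.trans_le hN⟩
  have hsup : ∀ x, (⨆ n ∈ S, ‖evol α (τ n) g x‖ₑ) ^ 2 = ⨆ N, F N x ^ 2 := by
    intro x
    rw [← ENNReal.iSup_pow]
    congr 1
    refine le_antisymm (iSup₂_le fun n hn => ?_) (iSup_le fun N => iSup₂_le fun n hn => ?_)
    · exact le_iSup_of_le (n + 1) (le_iSup₂_of_le n ⟨hn, n.lt_succ_self⟩ le_rfl)
    · exact le_iSup₂_of_le n hn.1 le_rfl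
  calc _ = ∫⁻ x, ⨆ N, F N x ^ 2 ∂μ := lintegral_congr hsup
    _ = ⨆ N, ∫⁻ x, F N x ^ 2 ∂μ := lintegral_iSup (fun N => (hFm N).pow_const 2)
        fun N N' hN x => pow_le_pow_left' (hmono hN x) 2
    _ ≤ c := iSup_le hfin

end Evolution

/-! ### Coordinate multiplication and the evolution of localized profiles -/

section Cutoff
open scoped ContDiff LineDeriv
variable {d : ℕ} {α t : ℝ}

/-- A smooth function with compact support in `ℝ^d ∖ {0}`. The origin is kept off the support
because the phase `(2π|ξ|)^α` is in general not smooth there. -/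
structure IsShellCutoff (ψ : Rd d → ℂ) : Prop where
  contDiff : ContDiff ℝ ∞ ψ
  hasCompactSupport : HasCompactSupport ψ
  zero_notMem : (0 : Rd d) ∉ tsupport ψ

theorem tsupport_dilation_subset (ψ : Rd d → ℂ) (M : ℝ) :
    tsupport (fun ξ => ψ (M⁻¹ • ξ)) ⊆ (fun ξ => M⁻¹ • ξ) ⁻¹' tsupport ψ :=
  tsupport_comp_subset_preimage ψ (continuous_const_smul _)

theorem IsShellCutoff.dilation {ψ : Rd d → ℂ} (hψ : IsShellCutoff ψ) {M : ℝ} (hM : 0 < M) :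
    IsShellCutoff (fun ξ => ψ (M⁻¹ • ξ)) where
  contDiff := hψ.contDiff.comp (contDiff_const_smul _)
  hasCompactSupport := 
    hψ.hasCompactSupport.comp_homeomorph (Homeomorph.smulOfNeZero M⁻¹ (by positivity))
  zero_notMem h := hψ.zero_notMem (by simpa using tsupport_dilation_subset ψ M h)

theorem IsShellCutoff.mul_contDiffAt {ψ a : Rd d → ℂ} (hψ : IsShellCutoff ψ)
    (ha : ∀ ξ ≠ 0, ContDiffAt ℝ ∞ a ξ) : IsShellCutoff (fun ξ => a ξ * ψ ξ) where
  contDiff := by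
    rw [contDiff_iff_contDiffAt]
    intro ξ
    by_cases h : ξ ∈ tsupport ψ
    · exact (ha ξ (fun h0 => hψ.zero_notMem (h0 ▸ h))).mul hψ.contDiff.contDiffAt
    · have h0 : (fun ξ => a ξ * ψ ξ) =ᶠ[nhds ξ] fun _ => 0 := by
        filter_upwards [notMem_tsupport_iff_eventuallyEq.1 h] with ζ hζ
        rw [hζ]; simp
      exact contDiffAt_const.congr_of_eventuallyEq h0
  hasCompactSupport := hψ.hasCompactSupport.mul_left
  zero_notMem h := hψ.zero_notMem (closure_mono (Function.support_mul_subset_right _ _) h)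

theorem IsShellCutoff.fderiv_apply {ψ : Rd d → ℂ} (hψ : IsShellCutoff ψ) (v : Rd d) :
    IsShellCutoff (fun ξ => fderiv ℝ ψ ξ v) where
  contDiff := (hψ.contDiff.fderiv_right (m := ∞) (by simp)).clm_apply contDiff_const
  hasCompactSupport := hψ.hasCompactSupport.fderiv_apply (𝕜 := ℝ) v
  zero_notMem h := hψ.zero_notMem (tsupport_fderiv_apply_subset ℝ v h)

theorem IsShellCutoff.hasTemperateGrowth {ψ : Rd d → ℂ} (hψ : IsShellCutoff ψ) :
    ψ.HasTemperateGrowth :=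
  hψ.hasCompactSupport.hasTemperateGrowth hψ.contDiff

/-- The phase `(2π|ξ|)^α`, so that `schrodingerSymbol α t ξ = exp (i t phase α ξ)`. -/
def phase (α : ℝ) (ξ : Rd d) : ℝ := (2 * Real.pi * ‖ξ‖) ^ α

theorem contDiffAt_phase (α : ℝ) {ξ : Rd d} (hξ : ξ ≠ 0) : ContDiffAt ℝ ∞ (phase α) ξ := by
  unfold phase
  exact (contDiffAt_const.mul (contDiffAt_norm ℝ hξ)).rpow_const_of_ne (by positivity)

theorem phase_smul (α : ℝ) {M : ℝ} (hM : 0 < M) (ξ : Rd d) :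
    phase α (M • ξ) = M ^ α * phase α ξ := by
  unfold phase
  rw [norm_smul, Real.norm_of_nonneg hM.le, ← Real.mul_rpow hM.le (by positivity)]
  congr 1; ring

theorem fderiv_phase_smul (α : ℝ) {M : ℝ} (hM : 0 < M) (ξ v : Rd d) :
    fderiv ℝ (phase α) ξ v = M ^ α * M⁻¹ * fderiv ℝ (phase α) (M⁻¹ • ξ) v := by
  have h : (phase α : Rd d → ℝ) = fun ξ => M ^ α * phase α (M⁻¹ • ξ) := by
    ext ξ
    rw [← phase_smul α hM, smul_smul, mul_inv_cancel₀ hM.ne', one_smul]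
  conv_lhs => rw [h]
  have h2 : (fun ξ : Rd d => M ^ α * phase α (M⁻¹ • ξ)) =
      (M ^ α) • fun ξ : Rd d => phase α (M⁻¹ • ξ) := rfl
  rw [h2, fderiv_const_smul_field, Pi.smul_apply, fderiv_comp_smul]
  simp [mul_assoc]

theorem contDiffAt_schrodingerSymbol (α t : ℝ) {ξ : Rd d} (hξ : ξ ≠ 0) :
    ContDiffAt ℝ ∞ (schrodingerSymbol α t) ξ := by
  unfold schrodingerSymbol
  have := contDiffAt_phase α hξ
  unfold phase at this
  exact (contDiffAt_const.mul (Complex.ofRealCLM.contDiff.contDiffAt.comp ξ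
    (contDiffAt_const.mul this))).cexp

theorem fderiv_schrodingerSymbol (α t : ℝ) {ξ : Rd d} (hξ : ξ ≠ 0) (v : Rd d) :
    fderiv ℝ (schrodingerSymbol α t) ξ v =
      schrodingerSymbol α t ξ * (Complex.I * t * (fderiv ℝ (phase α) ξ v : ℝ)) := by
  have h1 := ((contDiffAt_phase α hξ).differentiableAt (by simp)).hasFDerivAt
  have h2 : HasFDerivAt (fun ζ : Rd d => Complex.I * ((t * phase α ζ : ℝ) : ℂ)) _ ξ :=
    ((Complex.ofRealCLM.hasFDerivAt.comp ξ (h1.const_mul t)).const_mul Complex.I)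
  have h3 : HasFDerivAt (schrodingerSymbol (d := d) α t) _ ξ := h2.cexp
  rw [h3.fderiv]
  simp [schrodingerSymbol, phase]
  ring

theorem IsShellCutoff.fderiv_phase_mul {ψ : Rd d → ℂ} (hψ : IsShellCutoff ψ) (v : Rd d) :
    IsShellCutoff (fun ξ => ((fderiv ℝ (phase α) ξ v : ℝ) : ℂ) * ψ ξ) :=
  hψ.mul_contDiffAt fun ξ hξ => Complex.ofRealCLM.contDiff.contDiffAt.comp ξ
    (((contDiffAt_phase α hξ).fderiv_right (m := ∞) (by simp)).clm_apply contDiffAt_const)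

theorem IsShellCutoff.integrable_mul {ψ : Rd d → ℂ} (hψ : IsShellCutoff ψ) (H : 𝓢(Rd d, ℂ)) :
    Integrable (fun ξ => ψ ξ * H ξ) := by
  have := (smulLeftCLM ℂ ψ H).integrable (μ := volume)
  simpa [smulLeftCLM_apply hψ.hasTemperateGrowth] using this

/-- Multiplication of `h` by the coordinate `⟨x, v⟩` commutes with the frequency-localized evolution
up to two terms of the same form, in which the cutoff `ψ` is replaced by `∂_v ψ` and by
`(∂_v phase) ψ`; the latter carries a factor `t`. On the frequency side the coordinate is a
derivative, and this is the product rule for `schrodingerSymbol α t * ψ * 𝓕 h`. -/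
theorem evolFun_mul_fourier_inner_smul {ψ : Rd d → ℂ} (hψ : IsShellCutoff ψ) (h : 𝓢(Rd d, ℂ))
    (v x : Rd d) :
    evolFun α t
        (fun ξ => ψ ξ * (𝓕 (smulLeftCLM ℂ (fun x : Rd d => inner ℝ x v) h) : 𝓢(Rd d, ℂ)) ξ) x
      = inner ℝ x v * evolFun α t (fun ξ => ψ ξ * (𝓕 h : 𝓢(Rd d, ℂ)) ξ) x
        + (2 * Real.pi * Complex.I)⁻¹ *
          evolFun α t (fun ξ => fderiv ℝ ψ ξ v * (𝓕 h : 𝓢(Rd d, ℂ)) ξ) x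
        + (2 * Real.pi : ℂ)⁻¹ * t * evolFun α t
          (fun ξ => ((fderiv ℝ (phase α) ξ v : ℝ) : ℂ) * ψ ξ * (𝓕 h : 𝓢(Rd d, ℂ)) ξ) x := by
  have hpi : (2 * Real.pi * Complex.I : ℂ) ≠ 0 := by simp
  set H : 𝓢(Rd d, ℂ) := 𝓕 h with hH
  have hΦ : IsShellCutoff (fun ξ => schrodingerSymbol α t ξ * ψ ξ) :=
    hψ.mul_contDiffAt fun ξ hξ => contDiffAt_schrodingerSymbol α t hξ
  set K : 𝓢(Rd d, ℂ) := smulLeftCLM ℂ (fun ξ => schrodingerSymbol α t ξ * ψ ξ) H with hK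
  have hKa : ∀ ξ, K ξ = schrodingerSymbol α t ξ * ψ ξ * H ξ := fun ξ => by
    rw [hK, smulLeftCLM_apply_apply hΦ.hasTemperateGrowth]; rfl
  have hKx : evolFun α t (fun ξ => ψ ξ * H ξ) x = (𝓕⁻ K) x := by
    rw [evolFun, SchwartzMap.fourierInv_coe]
    refine congrArg (fun F : Rd d → ℂ => 𝓕⁻ F x) (funext fun ξ => ?_)
    rw [hKa]; ring
  have hX : ∀ ξ, (𝓕 (smulLeftCLM ℂ (fun x : Rd d => inner ℝ x v) h) : 𝓢(Rd d, ℂ)) ξ =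
      -(2 * Real.pi * Complex.I)⁻¹ * (∂_{v} H) ξ := by
    intro ξ
    rw [hH, SchwartzMap.lineDerivOp_fourier_eq, FourierTransform.fourier_smul]
    rw [smul_apply, smul_eq_mul]
    field_simp
  have hdK : ∀ ξ, (∂_{v} K) ξ = schrodingerSymbol α t ξ * (ψ ξ * (∂_{v} H) ξ) +
      (schrodingerSymbol α t ξ * (fderiv ℝ ψ ξ v * H ξ) +
        Complex.I * t *
          (schrodingerSymbol α t ξ * (((fderiv ℝ (phase α) ξ v : ℝ) : ℂ) * ψ ξ * H ξ))) := by
    intro ξ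
    have e1 : (K : Rd d → ℂ) = fun ξ => (schrodingerSymbol α t ξ * ψ ξ) * H ξ := funext hKa
    have e2 : fderiv ℝ (fun ξ => schrodingerSymbol α t ξ * ψ ξ) ξ v =
        schrodingerSymbol α t ξ * fderiv ℝ ψ ξ v +
        Complex.I * t * (schrodingerSymbol α t ξ * (((fderiv ℝ (phase α) ξ v : ℝ) : ℂ) * ψ ξ)) := by
      by_cases hξ : ξ ∈ tsupport ψ
      · have hξ0 : ξ ≠ 0 := fun h0 => hψ.zero_notMem (h0 ▸ hξ)
        rw [fderiv_fun_mul ((contDiffAt_schrodingerSymbol α t hξ0).differentiableAt (by simp))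
          (hψ.contDiff.differentiable (by simp)).differentiableAt]
        simp [fderiv_schrodingerSymbol α t hξ0]
        ring
      · have h0 := notMem_tsupport_iff_eventuallyEq.1 hξ
        have h1 : (fun ξ => schrodingerSymbol α t ξ * ψ ξ) =ᶠ[nhds ξ] fun _ => 0 := by
          filter_upwards [h0] with ζ hζ
          rw [hζ]; simp
        rw [h1.fderiv_eq, h0.fderiv_eq, h0.eq_of_nhds]
        simp
    rw [SchwartzMap.lineDerivOp_apply_eq_fderiv, SchwartzMap.lineDerivOp_apply_eq_fderiv, e1,
      fderiv_fun_mul (hΦ.contDiff.differentiable (by simp)).differentiableAt H.differentiableAt]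
    simp only [add_apply, smul_apply, smul_eq_mul, e2]
    ring
  have i1 := hψ.integrable_mul (∂_{v} H)
  have i2 := (hψ.fderiv_apply v).integrable_mul H
  have i3 := (hψ.fderiv_phase_mul (α := α) v).integrable_mul H
  have i4 : Integrable (fun ξ => fderiv ℝ ψ ξ v * H ξ +
      Complex.I * t * (((fderiv ℝ (phase α) ξ v : ℝ) : ℂ) * ψ ξ * H ξ)) := i2.add (i3.const_mul _)
  have main := congrArg (fun F : 𝓢(Rd d, ℂ) => F x) (SchwartzMap.fourierInv_lineDerivOp_eq K v)
  have hl : (𝓕⁻ (∂_{v} K) : 𝓢(Rd d, ℂ)) x = evolFun α t (fun ξ => ψ ξ * (∂_{v} H) ξ) x +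
      (evolFun α t (fun ξ => fderiv ℝ ψ ξ v * H ξ) x + Complex.I * t *
        evolFun α t (fun ξ => ((fderiv ℝ (phase α) ξ v : ℝ) : ℂ) * ψ ξ * H ξ) x) := by
    rw [← evolFun_const_mul, ← evolFun_add i2 (i3.const_mul _),
      ← evolFun_add i1 i4, evolFun, SchwartzMap.fourierInv_coe]
    refine congrArg (fun F : Rd d → ℂ => 𝓕⁻ F x) (funext fun ξ => ?_)
    rw [hdK]; ring
  have hr : (-(2 * Real.pi * Complex.I) • smulLeftCLM ℂ (fun x : Rd d => inner ℝ x v) (𝓕⁻ K)) x =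
      -(2 * Real.pi * Complex.I) * (inner ℝ x v * (𝓕⁻ K) x) := by
    rw [smul_apply, smulLeftCLM_apply_apply (by fun_prop), smul_eq_mul, Complex.real_smul]
  rw [hl, hr, ← hKx] at main
  have hlhs : evolFun α t (fun ξ => ψ ξ *
      (𝓕 (smulLeftCLM ℂ (fun x : Rd d => inner ℝ x v) h) : 𝓢(Rd d, ℂ)) ξ) x =
      -(2 * Real.pi * Complex.I)⁻¹ * evolFun α t (fun ξ => ψ ξ * (∂_{v} H) ξ) x := by
    rw [← evolFun_const_mul]
    congr 1; funext ξ; rw [hX]; ring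
  rw [hlhs, eq_sub_of_add_eq main]
  field_simp
  ring

end Cutoff

/-! ### Rescaling the local estimate -/

section LocalEstimates
variable {d : ℕ} {α s : ℝ} {C : ℝ≥0}

theorem setLIntegral_ball_eq (F : Rd d → ℝ≥0∞) (y : Rd d) {ρ : ℝ} (hρ : 0 < ρ) :
    ∫⁻ x in ball y ρ, F x = ENNReal.ofReal (ρ ^ d) * ∫⁻ z in ball 0 1, F (y + ρ • z) := by
  rw [← lintegral_indicator measurableSet_ball, ← lintegral_indicator measurableSet_ball,
    ← lintegral_comp_smul_inv _ hρ, ← lintegral_add_left_eq_self _ y]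
  refine lintegral_congr fun x => ?_
  have h1 : y + x ∈ ball y ρ ↔ ρ⁻¹ • x ∈ ball (0 : Rd d) 1 := by
    rw [mem_ball_iff_norm, mem_ball_zero_iff, norm_smul, Real.norm_of_nonneg (by positivity),
      add_sub_cancel_left, inv_mul_lt_iff₀ hρ, mul_one]
  by_cases h : y + x ∈ ball y ρ
  · rw [indicator_of_mem h, indicator_of_mem (h1.1 h), smul_smul, mul_inv_cancel₀ hρ.ne', one_smul]
  · rw [indicator_of_notMem h, indicator_of_notMem (fun h' => h (h1.2 h'))]

/-- The local maximal estimate on the unit ball with squared constant `C`, for the nonzero times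
`|t| ≤ 1` and in terms of frequency profiles. -/
def IsLocalBound (d : ℕ) (α s : ℝ) (C : ℝ≥0) : Prop :=
  ∀ G : 𝓢(Rd d, ℂ), ∫⁻ x in ball 0 1, maxFun α {t | t ≠ 0 ∧ |t| ≤ 1} G x ^ 2 ≤
    C * ∫⁻ η, ENNReal.ofReal (sobolevWeight s η) * ‖G η‖ₑ ^ 2

theorem sobolevWeight_smul_le (hs : 0 ≤ s) {R : ℝ} (hR : 1 ≤ R) (ζ : Rd d) :
    sobolevWeight s (R • ζ) ≤ R ^ (2 * s) * sobolevWeight s ζ := by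
  have hR0 : 0 < R := by linarith
  unfold sobolevWeight
  rw [Real.rpow_mul hR0.le, ← Real.mul_rpow (by positivity) (by positivity), norm_smul,
    Real.norm_of_nonneg hR0.le]
  refine Real.rpow_le_rpow (by positivity) ?_ hs
  rw [Real.rpow_two]
  nlinarith [one_le_pow₀ hR (n := 2)]

/-- Rescaling the local bound: for frequencies comparable to `M`, on every ball of radius `R / M`
and for times up to `(R / M) ^ α`, with a loss of `R ^ (2 s)` and uniformly in the centre. -/
theorem IsLocalBound.exists_shell_ball (hC : IsLocalBound d α s C) (hs : 0 ≤ s) {ψ : Rd d → ℂ}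
    (hψ : IsShellCutoff ψ) :
    ∃ C' : ℝ≥0, ∀ (M R : ℝ) (y : Rd d) (H : 𝓢(Rd d, ℂ)), 0 < M → 1 ≤ R →
      ∫⁻ x in ball y (R / M), maxFun α {t | t ≠ 0 ∧ |t| ≤ (R / M) ^ α}
        (fun ξ => ψ (M⁻¹ • ξ) * H ξ) x ^ 2 ≤
      C' * ENNReal.ofReal (R ^ (2 * s)) * ∫⁻ ξ, ‖H ξ‖ₑ ^ 2 := by
  have hcont : Continuous fun ζ : Rd d => ((sobolevWeight s ζ : ℝ) : ℂ) * (ψ ζ) ^ 2 := by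
    have := hψ.contDiff.continuous
    have h2 : Continuous (sobolevWeight (d := d) s) :=
      Continuous.rpow_const (by fun_prop) fun ζ => Or.inl (by positivity)
    fun_prop
  have hsupp : HasCompactSupport fun ζ : Rd d => ((sobolevWeight s ζ : ℝ) : ℂ) * (ψ ζ) ^ 2 := by
    simp only [pow_two]
    exact (hψ.hasCompactSupport.mul_left).mul_left
  obtain ⟨A, hA⟩ := hcont.bounded_above_of_compact_support hsupp
  have hA0 : 0 ≤ A := (norm_nonneg _).trans (hA 0)
  refine ⟨C * A.toNNReal, fun M R y H hM hR => ?_⟩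
  set ρ := R / M with hρdef
  have hR0 : 0 < R := by linarith
  have hρ : 0 < ρ := by positivity
  have hψM := hψ.dilation hM
  set K : 𝓢(Rd d, ℂ) := smulLeftCLM ℂ (fun ξ => ψ (M⁻¹ • ξ)) H with hK
  have hKa : ∀ ξ, K ξ = ψ (M⁻¹ • ξ) * H ξ := fun ξ => by
    rw [hK, smulLeftCLM_apply_apply hψM.hasTemperateGrowth]; rfl
  have hKf : (fun ξ => ψ (M⁻¹ • ξ) * H ξ) = K := (funext hKa).symm
  -- the dilated and modulated profile
  set e : Rd d → ℂ := fun η =>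
    Complex.exp ((2 * Real.pi * inner ℝ (ρ⁻¹ • η) y : ℝ) * Complex.I) * K (ρ⁻¹ • η) with he
  have hKsupp : HasCompactSupport (K : Rd d → ℂ) := by
    rw [← hKf]; exact hψM.hasCompactSupport.mul_right
  have hes : HasCompactSupport e :=
    (hKsupp.comp_homeomorph (Homeomorph.smulOfNeZero ρ⁻¹ (by positivity))).mul_left
  have hec : ContDiff ℝ ((⊤ : ℕ∞) : WithTop ℕ∞) e := by
    refine ContDiff.mul ?_ ((K.smooth ⊤).comp (contDiff_const_smul _))
    refine ContDiff.cexp (ContDiff.mul (Complex.ofRealCLM.contDiff.comp ?_) contDiff_const)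
    exact contDiff_const.mul ((contDiff_const_smul _).inner ℝ contDiff_const)
  set E : 𝓢(Rd d, ℂ) := hes.toSchwartzMap hec with hE
  have hEa : (E : Rd d → ℂ) = e := rfl
  have hEn : ∀ η, ‖E η‖ₑ = ‖K (ρ⁻¹ • η)‖ₑ := fun η => by
    rw [hEa, he, enorm_mul, ← ofReal_norm, Complex.norm_exp_ofReal_mul_I, ENNReal.ofReal_one,
      one_mul]
  have hpt : ∀ z : Rd d, maxFun α {t | t ≠ 0 ∧ |t| ≤ ρ ^ α} K (y + ρ • z) ^ 2 ≤
      ENNReal.ofReal ((ρ ^ d)⁻¹ ^ 2) * maxFun α {t | t ≠ 0 ∧ |t| ≤ 1} E z ^ 2 := by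
    intro z
    rw [ENNReal.ofReal_pow (by positivity), ← mul_pow]
    refine pow_le_pow_left' (maxFun_le_iff.2 ?_) 2
    rintro t ⟨ht0, ht⟩
    rw [evolFun_add_smul hρ y z, enorm_mul]
    change _ * ‖evolFun α _ E z‖ₑ ≤ _
    have hn : ‖((ρ ^ d : ℝ) : ℂ)⁻¹‖ₑ = ENNReal.ofReal (ρ ^ d)⁻¹ := by
      rw [← ofReal_norm, norm_inv, Complex.norm_real, Real.norm_of_nonneg (by positivity)]
    rw [hn]
    refine mul_le_mul_right (enorm_evolFun_le_maxFun (Θ := {t | t ≠ 0 ∧ |t| ≤ 1})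
      ⟨?_, ?_⟩ z) _
    · exact mul_ne_zero ht0 (by positivity)
    · have h0 : 0 < ρ ^ α := by positivity
      rw [abs_mul, abs_of_pos (inv_pos.2 h0), ← div_eq_mul_inv, div_le_one h0]
      exact ht
  have hwt : ∀ ξ, ENNReal.ofReal (sobolevWeight s (ρ • ξ)) * ‖K ξ‖ₑ ^ 2 ≤
      A.toNNReal * ENNReal.ofReal (R ^ (2 * s)) * ‖H ξ‖ₑ ^ 2 := by
    intro ξ
    have h1 : sobolevWeight s (ρ • ξ) ≤ R ^ (2 * s) * sobolevWeight s (M⁻¹ • ξ) := by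
      have := sobolevWeight_smul_le hs hR (M⁻¹ • ξ)
      rwa [smul_smul, ← div_eq_mul_inv] at this
    have h2 := hA (M⁻¹ • ξ)
    have hw : 0 ≤ sobolevWeight s (M⁻¹ • ξ) := by unfold sobolevWeight; positivity
    rw [norm_mul, Complex.norm_real, Real.norm_of_nonneg hw, norm_pow] at h2
    rw [hKa, enorm_mul, mul_pow, ← mul_assoc]
    refine mul_le_mul_left ?_ _
    rw [← ofReal_norm, ← ENNReal.ofReal_pow (norm_nonneg _), ← ENNReal.ofReal_mul
      (by unfold sobolevWeight; positivity)]
    change _ ≤ ENNReal.ofReal A * _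
    rw [← ENNReal.ofReal_mul hA0]
    refine ENNReal.ofReal_le_ofReal ?_
    calc _ ≤ R ^ (2 * s) * sobolevWeight s (M⁻¹ • ξ) * ‖ψ (M⁻¹ • ξ)‖ ^ 2 := by gcongr
      _ = R ^ (2 * s) * (sobolevWeight s (M⁻¹ • ξ) * ‖ψ (M⁻¹ • ξ)‖ ^ 2) := by ring
      _ ≤ R ^ (2 * s) * A := by gcongr
      _ = _ := mul_comm _ _
  have hscale : ∫⁻ η, ENNReal.ofReal (sobolevWeight s η) * ‖E η‖ₑ ^ 2 =
      ENNReal.ofReal (ρ ^ d) * ∫⁻ ξ, ENNReal.ofReal (sobolevWeight s (ρ • ξ)) * ‖K ξ‖ₑ ^ 2 := by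
    rw [← lintegral_comp_smul_inv _ hρ]
    refine lintegral_congr fun η => ?_
    rw [hEn, smul_smul, mul_inv_cancel₀ hρ.ne', one_smul]
  rw [hKf, setLIntegral_ball_eq _ y hρ]
  have hone : ENNReal.ofReal (ρ ^ d) *
      (ENNReal.ofReal ((ρ ^ d)⁻¹ ^ 2) * ENNReal.ofReal (ρ ^ d)) = 1 := by
    rw [← ENNReal.ofReal_mul (by positivity), ← ENNReal.ofReal_mul (by positivity),
      ← ENNReal.ofReal_one]
    congr 1
    field_simp
  calc _ ≤ ENNReal.ofReal (ρ ^ d) * ∫⁻ z in ball 0 1, ENNReal.ofReal ((ρ ^ d)⁻¹ ^ 2) *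
          maxFun α {t | t ≠ 0 ∧ |t| ≤ 1} E z ^ 2 := mul_le_mul_right (lintegral_mono hpt) _
    _ = ENNReal.ofReal (ρ ^ d) * (ENNReal.ofReal ((ρ ^ d)⁻¹ ^ 2) *
          ∫⁻ z in ball 0 1, maxFun α {t | t ≠ 0 ∧ |t| ≤ 1} E z ^ 2) := by
        rw [lintegral_const_mul' _ _ ENNReal.ofReal_ne_top]
    _ ≤ ENNReal.ofReal (ρ ^ d) * (ENNReal.ofReal ((ρ ^ d)⁻¹ ^ 2) *
          (C * (ENNReal.ofReal (ρ ^ d) *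
            ∫⁻ ξ, A.toNNReal * ENNReal.ofReal (R ^ (2 * s)) * ‖H ξ‖ₑ ^ 2))) := by
        refine mul_le_mul_right (mul_le_mul_right ((hC E).trans ?_) _) _
        rw [hscale]
        exact mul_le_mul_right (mul_le_mul_right (lintegral_mono hwt) _) _
    _ = (ENNReal.ofReal (ρ ^ d) * (ENNReal.ofReal ((ρ ^ d)⁻¹ ^ 2) * ENNReal.ofReal (ρ ^ d))) *
          (C * (A.toNNReal * ENNReal.ofReal (R ^ (2 * s)) * ∫⁻ ξ, ‖H ξ‖ₑ ^ 2)) := by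
        rw [lintegral_const_mul' _ _ (ENNReal.mul_ne_top ENNReal.coe_ne_top ENNReal.ofReal_ne_top)]
        ring
    _ = _ := by
        rw [hone, one_mul, ENNReal.coe_mul]; ring

end LocalEstimates

/-! ### Weighted local estimates and the global shell estimate -/

section Weights
variable {d : ℕ} {α s : ℝ} {C : ℝ≥0}

theorem lintegral_enorm_toLp_sq (h : 𝓢(Rd d, ℂ)) :
    ∫⁻ x, ‖h x‖ₑ ^ 2 = ‖(h.toLp 2 volume : L2Rd d)‖ₑ ^ 2 := by
  rw [← lintegral_enorm_sq_eq]
  refine lintegral_congr_ae ?_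
  filter_upwards [h.coeFn_toLp 2 volume] with x hx
  rw [hx]

theorem lintegral_enorm_fourier_sq (h : 𝓢(Rd d, ℂ)) :
    ∫⁻ ξ, ‖(𝓕 h : 𝓢(Rd d, ℂ)) ξ‖ₑ ^ 2 = ∫⁻ x, ‖h x‖ₑ ^ 2 := by
  rw [lintegral_enorm_toLp_sq, lintegral_enorm_toLp_sq, ← SchwartzMap.toLp_fourier_eq,
    ← ofReal_norm, Lp.norm_fourier_eq, ofReal_norm]

/-- The complex affine function `1 + i ⟨x - y, v⟩ / ρ`. It never vanishes, which is the reason for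
the imaginary unit, and is bounded on `ball y ρ` if `‖v‖ ≤ 1`. -/
def affineWeight (ρ : ℝ) (y v x : Rd d) : ℂ := 1 + Complex.I * ((inner ℝ (x - y) v / ρ : ℝ) : ℂ)

theorem affineWeight_hasTemperateGrowth (ρ : ℝ) (y v : Rd d) :
    (affineWeight ρ y v).HasTemperateGrowth := by
  unfold affineWeight
  simp only [inner_sub_left, div_eq_mul_inv]
  fun_prop

theorem normSq_affineWeight (ρ : ℝ) (y v x : Rd d) :
    ‖affineWeight ρ y v x‖ ^ 2 = 1 + (inner ℝ (x - y) v / ρ) ^ 2 := by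
  rw [← Complex.normSq_eq_norm_sq, affineWeight, Complex.normSq_apply]
  simp
  ring

theorem affineWeight_ne_zero (ρ : ℝ) (y v x : Rd d) : affineWeight ρ y v x ≠ 0 := by
  intro h
  have := normSq_affineWeight ρ y v x
  rw [h, norm_zero] at this
  nlinarith [sq_nonneg (inner ℝ (x - y) v / ρ)]

theorem affineWeight_inv_hasTemperateGrowth (ρ : ℝ) (y v : Rd d) :
    (fun x => (affineWeight ρ y v x)⁻¹).HasTemperateGrowth := by
  -- `(1 + i u)⁻¹ = (1 - i u) (1 + u²)⁻¹`
  have h1 : (fun u : ℝ => (1 - Complex.I * (u : ℂ)) *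
      (((1 + ‖u‖ ^ 2) ^ (-1 : ℝ) : ℝ) : ℂ)).HasTemperateGrowth := by
    have := Function.hasTemperateGrowth_one_add_norm_sq_rpow ℝ (-1)
    fun_prop
  have h2 : (fun x : Rd d => (inner ℝ (x - y) v / ρ : ℝ)).HasTemperateGrowth := by
    simp only [inner_sub_left, div_eq_mul_inv]
    fun_prop
  convert h1.comp h2 using 1
  funext x
  have h0 := affineWeight_ne_zero ρ y v x
  rw [Function.comp_apply, inv_eq_iff_eq_inv]
  set u : ℝ := inner ℝ (x - y) v / ρ with hu
  have hp : (0 : ℝ) < 1 + u ^ 2 := by positivity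
  have e : ((1 : ℂ) - Complex.I * u) * (1 + Complex.I * u) = ((1 + u ^ 2 : ℝ) : ℂ) := by
    push_cast
    linear_combination -(u : ℂ) ^ 2 * Complex.I_mul_I
  rw [affineWeight, ← hu, eq_comm, inv_eq_iff_eq_inv, Real.norm_eq_abs, sq_abs, Real.rpow_neg_one,
    Complex.ofReal_inv]
  rw [affineWeight, ← hu] at h0
  rw [mul_inv_eq_iff_eq_mul₀ (by exact_mod_cast hp.ne'), ← e, eq_inv_mul_iff_mul_eq₀ h0, mul_comm]

/-- Multiplication of a Schwartz function by `affineWeight ρ y v`. -/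
def weightMul (ρ : ℝ) (y v : Rd d) (h : 𝓢(Rd d, ℂ)) : 𝓢(Rd d, ℂ) :=
  smulLeftCLM ℂ (affineWeight ρ y v) h

theorem weightMul_apply (ρ : ℝ) (y v : Rd d) (h : 𝓢(Rd d, ℂ)) (x : Rd d) :
    weightMul ρ y v h x = affineWeight ρ y v x * h x := by
  rw [weightMul, smulLeftCLM_apply_apply (affineWeight_hasTemperateGrowth ρ y v), smul_eq_mul]

theorem weightMul_eq (ρ : ℝ) (y v : Rd d) (h : 𝓢(Rd d, ℂ)) :
    weightMul ρ y v h = (1 - Complex.I * ((inner ℝ y v / ρ : ℝ) : ℂ)) • h +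
      (Complex.I * ((ρ⁻¹ : ℝ) : ℂ)) • smulLeftCLM ℂ (fun x : Rd d => inner ℝ x v) h := by
  ext x
  rw [weightMul_apply, add_apply, smul_apply, smul_apply, smulLeftCLM_apply_apply (by fun_prop),
    affineWeight, inner_sub_left, Complex.real_smul, smul_eq_mul, smul_eq_mul]
  push_cast
  ring

/-- The weight `∏_{v ∈ L} (1 + ⟨z, v⟩²)⁻¹`. -/
def decayWeight (L : List (Rd d)) (z : Rd d) : ℝ :=
  (L.map fun v => (1 + inner ℝ z v ^ 2)⁻¹).prod

theorem decayWeight_nonneg (L : List (Rd d)) (z : Rd d) : 0 ≤ decayWeight L z := by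
  refine List.prod_nonneg fun a ha => ?_
  obtain ⟨v, -, rfl⟩ := List.mem_map.1 ha
  positivity

/-- Every Schwartz function is a product of affine weights with another one, whose square is smaller
by the factor `decayWeight`. -/
theorem exists_foldr_weightMul_eq (ρ : ℝ) (y : Rd d) (L : List (Rd d)) (f : 𝓢(Rd d, ℂ)) :
    ∃ h : 𝓢(Rd d, ℂ), L.foldr (weightMul ρ y) h = f ∧
      ∀ x, ‖h x‖ ^ 2 = decayWeight L (ρ⁻¹ • (x - y)) * ‖f x‖ ^ 2 := by
  induction L generalizing f with
  | nil => exact ⟨f, rfl, fun x => by simp [decayWeight]⟩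
  | cons v L ih =>
    obtain ⟨h, h1, h2⟩ := ih (smulLeftCLM ℂ (fun x => (affineWeight ρ y v x)⁻¹) f)
    refine ⟨h, ?_, fun x => ?_⟩
    · rw [List.foldr_cons, h1]
      ext x
      rw [weightMul_apply, smulLeftCLM_apply_apply (affineWeight_inv_hasTemperateGrowth ρ y v),
        smul_eq_mul, mul_inv_cancel_left₀ (affineWeight_ne_zero ρ y v x)]
    · rw [h2, smulLeftCLM_apply_apply (affineWeight_inv_hasTemperateGrowth ρ y v), smul_eq_mul,
        norm_mul, norm_inv, mul_pow, inv_pow, normSq_affineWeight]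
      simp only [decayWeight, List.map_cons, List.prod_cons]
      rw [real_inner_smul_left, ← div_eq_inv_mul]
      ring

/-- The list of the standard basis vectors of `ℝ^d`. -/
def coordList (d : ℕ) : List (Rd d) := (List.finRange d).map fun j => EuclideanSpace.single j 1

theorem norm_le_one_of_mem_coordList {v : Rd d} (hv : v ∈ coordList d) : ‖v‖ ≤ 1 := by
  obtain ⟨j, -, rfl⟩ := List.mem_map.1 hv
  simp

/-- In coordinates `decayWeight (coordList d)` is the product of the functions `(1 + z_j²)⁻¹`. -/
theorem integrable_decayWeight_coordList : Integrable (decayWeight (coordList d)) := by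
  have h := Integrable.fintype_prod (μ := fun _ : Fin d => (volume : Measure ℝ))
    (f := fun _ u => (1 + u ^ 2)⁻¹) fun _ => integrable_inv_one_add_sq
  have h2 := (
    (EuclideanSpace.volume_preserving_symm_measurableEquiv_toLp (Fin d)).integrable_comp_emb
      (MeasurableEquiv.measurableEmbedding _)).2 h
  refine h2.congr ?_
  filter_upwards with z
  simp [decayWeight, coordList, List.map_map, Function.comp_def, EuclideanSpace.inner_single_right]
  rw [← List.prod_ofFn, List.ofFn_eq_map, List.prod_inv, List.map_map]
  rfl

end Weights

section Weighted
open scoped ContDiff LineDeriv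
variable {d : ℕ} {α s : ℝ} {C : ℝ≥0}

/-- The commutation of the affine weight of scale `R / M` with the evolution at frequency `M`. The
coefficients of the two error terms are bounded for `R ≥ 1` and `|t| ≤ R M ^ (-α)`. -/
theorem evolFun_weightMul {t : ℝ} {ψ : Rd d → ℂ} (hψ : IsShellCutoff ψ) {M R : ℝ} (hM : 0 < M)
    (hR : 0 < R) (y v x : Rd d) (h : 𝓢(Rd d, ℂ)) :
    evolFun α t (fun ξ => ψ (M⁻¹ • ξ) * (𝓕 (weightMul (R / M) y v h) : 𝓢(Rd d, ℂ)) ξ) x =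
      affineWeight (R / M) y v x * evolFun α t (fun ξ => ψ (M⁻¹ • ξ) * (𝓕 h : 𝓢(Rd d, ℂ)) ξ) x
      + ((2 * Real.pi * R)⁻¹ : ℝ) *
        evolFun α t (fun ξ => fderiv ℝ ψ (M⁻¹ • ξ) v * (𝓕 h : 𝓢(Rd d, ℂ)) ξ) x
      + Complex.I * ((2 * Real.pi)⁻¹ * (t * M ^ α / R) : ℝ) * evolFun α t
        (fun ξ => ((fderiv ℝ (phase α) (M⁻¹ • ξ) v : ℝ) : ℂ) * ψ (M⁻¹ • ξ) *
          (𝓕 h : 𝓢(Rd d, ℂ)) ξ) x := by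
  have hψM := hψ.dilation hM
  have key := evolFun_mul_fourier_inner_smul (α := α) (t := t) hψM h v x
  set H : 𝓢(Rd d, ℂ) := 𝓕 h with hH
  set X : 𝓢(Rd d, ℂ) := smulLeftCLM ℂ (fun x : Rd d => inner ℝ x v) h with hX
  have e1 : (fun ξ => ψ (M⁻¹ • ξ) * (𝓕 (weightMul (R / M) y v h) : 𝓢(Rd d, ℂ)) ξ) =
      fun ξ => (1 - Complex.I * ((inner ℝ y v / (R / M) : ℝ) : ℂ)) * (ψ (M⁻¹ • ξ) * H ξ) +
      (Complex.I * (((R / M)⁻¹ : ℝ) : ℂ)) * (ψ (M⁻¹ • ξ) * (𝓕 X : 𝓢(Rd d, ℂ)) ξ) := by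
    funext ξ
    rw [weightMul_eq, FourierTransform.fourier_add, FourierTransform.fourier_smul,
      FourierTransform.fourier_smul, add_apply, smul_apply, smul_apply, smul_eq_mul, smul_eq_mul]
    ring
  have e2 : (fun ξ => fderiv ℝ (fun ξ => ψ (M⁻¹ • ξ)) ξ v * H ξ) =
      fun ξ => ((M⁻¹ : ℝ) : ℂ) * (fderiv ℝ ψ (M⁻¹ • ξ) v * H ξ) := by
    funext ξ
    rw [fderiv_comp_smul, smul_apply, Complex.real_smul, mul_assoc]
  have e3 : (fun ξ => ((fderiv ℝ (phase α) ξ v : ℝ) : ℂ) * ψ (M⁻¹ • ξ) * H ξ) =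
      fun ξ => ((M ^ α * M⁻¹ : ℝ) : ℂ) *
        (((fderiv ℝ (phase α) (M⁻¹ • ξ) v : ℝ) : ℂ) * ψ (M⁻¹ • ξ) * H ξ) := by
    funext ξ
    rw [fderiv_phase_smul α hM]
    push_cast; ring
  rw [e2, e3, evolFun_const_mul, evolFun_const_mul] at key
  rw [e1, evolFun_add ((hψM.integrable_mul _).const_mul _) ((hψM.integrable_mul _).const_mul _),
    evolFun_const_mul, evolFun_const_mul, key, affineWeight, inner_sub_left]
  have hMc : (M : ℂ) ≠ 0 := by exact_mod_cast hM.ne'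
  have hRc : (R : ℂ) ≠ 0 := by exact_mod_cast hR.ne'
  have hpc : (Real.pi : ℂ) ≠ 0 := by exact_mod_cast Real.pi_ne_zero
  push_cast
  field_simp
  ring

/-- The rescaled local bound with a gain: when the data is a product of affine weights centred at
`y` with `h`, the `L²` norm of `h` alone suffices on the ball about `y`. The statement is uniform
over the cutoffs `ψ`, because the induction step replaces `ψ` by other shell cutoffs. -/
theorem IsLocalBound.exists_weighted (hC : IsLocalBound d α s C) (hs : 0 ≤ s) (L : List (Rd d))
    (hL : ∀ v ∈ L, ‖v‖ ≤ 1) :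
    ∀ ψ : Rd d → ℂ, IsShellCutoff ψ → ∃ C' : ℝ≥0, ∀ (M R : ℝ) (y : Rd d) (h : 𝓢(Rd d, ℂ)),
      0 < M → 1 ≤ R →
      ∫⁻ x in ball y (R / M), maxFun α {t | t ≠ 0 ∧ |t| ≤ min R (R ^ α) * (M ^ α)⁻¹}
        (fun ξ => ψ (M⁻¹ • ξ) * (𝓕 (L.foldr (weightMul (R / M) y) h) : 𝓢(Rd d, ℂ)) ξ) x ^ 2 ≤
      C' * ENNReal.ofReal (R ^ (2 * s)) * ∫⁻ x, ‖h x‖ₑ ^ 2 := by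
  induction L with
  | nil =>
    intro ψ hψ
    obtain ⟨C', hC'⟩ := hC.exists_shell_ball hs hψ
    refine ⟨C', fun M R y h hM hR => ?_⟩
    have hP : ∫⁻ ξ, ‖(𝓕 h : 𝓢(Rd d, ℂ)) ξ‖ₑ ^ 2 = ∫⁻ x, ‖h x‖ₑ ^ 2 :=
      lintegral_enorm_fourier_sq h
    refine le_trans (lintegral_mono fun x => pow_le_pow_left' (maxFun_mono ?_ x) 2)
      ((hC' M R y (𝓕 h) hM hR).trans (le_of_eq (by rw [hP])))
    rintro t ⟨ht0, ht⟩
    refine ⟨ht0, ht.trans ?_⟩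
    rw [Real.div_rpow (by linarith) hM.le, div_eq_mul_inv]
    gcongr
    exact min_le_right _ _
  | cons v L ih =>
    intro ψ hψ
    have ih := ih fun w hw => hL w (List.mem_cons_of_mem _ hw)
    obtain ⟨C₁, h₁⟩ := ih ψ hψ
    obtain ⟨C₂, h₂⟩ := ih _ (hψ.fderiv_apply v)
    obtain ⟨C₃, h₃⟩ := ih _ (hψ.fderiv_phase_mul (α := α) v)
    refine ⟨8 * C₁ + 4 * C₂ + 4 * C₃, fun M R y h hM hR => ?_⟩
    have hR0 : 0 < R := by linarith
    specialize h₁ M R y h hM hR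
    specialize h₂ M R y h hM hR
    specialize h₃ M R y h hM hR
    set Θ : Set ℝ := {t | t ≠ 0 ∧ |t| ≤ min R (R ^ α) * (M ^ α)⁻¹} with hΘ
    set h' := L.foldr (weightMul (R / M) y) h with hh'
    rw [List.foldr_cons, ← hh']
    set F₁ := maxFun α Θ (fun ξ => ψ (M⁻¹ • ξ) * (𝓕 h' : 𝓢(Rd d, ℂ)) ξ) with hF₁
    set F₂ := maxFun α Θ (fun ξ => fderiv ℝ ψ (M⁻¹ • ξ) v * (𝓕 h' : 𝓢(Rd d, ℂ)) ξ) with hF₂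
    set F₃ := maxFun α Θ (fun ξ => ((fderiv ℝ (phase α) (M⁻¹ • ξ) v : ℝ) : ℂ) * ψ (M⁻¹ • ξ) *
          (𝓕 h' : 𝓢(Rd d, ℂ)) ξ) with hF₃
    have m₁ : Measurable F₁ := measurable_maxFun α Θ ((hψ.dilation hM).integrable_mul _)
    have m₂ : Measurable F₂ :=
      measurable_maxFun α Θ (((hψ.fderiv_apply v).dilation hM).integrable_mul _)
    have hpi : 1 ≤ 2 * Real.pi := by linarith [Real.pi_gt_three]
    have hpt : ∀ x ∈ ball y (R / M), maxFun α Θ (fun ξ => ψ (M⁻¹ • ξ) *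
        (𝓕 (weightMul (R / M) y v h') : 𝓢(Rd d, ℂ)) ξ) x ^ 2 ≤
        8 * F₁ x ^ 2 + 4 * F₂ x ^ 2 + 4 * F₃ x ^ 2 := by
      intro x hx
      have hle : maxFun α Θ (fun ξ => ψ (M⁻¹ • ξ) *
        (𝓕 (weightMul (R / M) y v h') : 𝓢(Rd d, ℂ)) ξ) x ≤ 2 * F₁ x + (F₂ x + F₃ x) := by
        refine maxFun_le_iff.2 fun t ht => ?_
        rw [evolFun_weightMul hψ hM hR0, add_assoc]
        refine (enorm_add_le _ _).trans (add_le_add ?_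
          ((enorm_add_le _ _).trans (add_le_add ?_ ?_)))
        -- the affine weight is bounded by `2` on the ball
        · rw [enorm_mul]
          refine mul_le_mul' ?_ (enorm_evolFun_le_maxFun ht x)
          rw [← ofReal_norm, ← ENNReal.ofReal_ofNat]
          refine ENNReal.ofReal_le_ofReal ?_
          refine (norm_add_le _ _).trans ?_
          rw [norm_one, norm_mul, Complex.norm_I, one_mul, Complex.norm_real, norm_div,
            Real.norm_of_nonneg (by positivity : 0 ≤ R / M)]
          have h1 : ‖inner ℝ (x - y) v‖ ≤ R / M * 1 :=
            (norm_inner_le_norm _ _).trans (mul_le_mul (mem_ball_iff_norm.1 hx).le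
              (hL v List.mem_cons_self) (norm_nonneg _) (by positivity))
          have := (div_le_one (by positivity : 0 < R / M)).2 (h1.trans (mul_one _).le)
          linarith
        · rw [enorm_mul]
          refine (mul_le_mul' ?_ (enorm_evolFun_le_maxFun ht x)).trans (one_mul _).le
          rw [← ofReal_norm, ← ENNReal.ofReal_one]
          refine ENNReal.ofReal_le_ofReal ?_
          rw [Complex.norm_real, Real.norm_of_nonneg (by positivity)]
          exact inv_le_one_of_one_le₀ (by nlinarith)
        · rw [enorm_mul]
          refine (mul_le_mul' ?_ (enorm_evolFun_le_maxFun ht x)).trans (one_mul _).le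
          rw [← ofReal_norm, ← ENNReal.ofReal_one]
          refine ENNReal.ofReal_le_ofReal ?_
          have hMa : 0 < M ^ α := by positivity
          have h1 : |t| ≤ R * (M ^ α)⁻¹ := ht.2.trans (by gcongr; exact min_le_left _ _)
          rw [← div_eq_mul_inv, le_div_iff₀ hMa] at h1
          rw [norm_mul, Complex.norm_I, one_mul, Complex.norm_real, norm_mul, norm_div, norm_mul,
            Real.norm_eq_abs t, Real.norm_of_nonneg hMa.le, Real.norm_of_nonneg hR0.le,
            Real.norm_of_nonneg (by positivity)]
          exact mul_le_one₀ (inv_le_one_of_one_le₀ hpi) (by positivity) ((div_le_one hR0).2 h1)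
      calc _ ≤ (2 * F₁ x + (F₂ x + F₃ x)) ^ 2 := pow_le_pow_left' hle 2
        _ ≤ 2 * ((2 * F₁ x) ^ 2 + (F₂ x + F₃ x) ^ 2) := ENNReal.add_sq_le_two_mul _ _
        _ ≤ 2 * ((2 * F₁ x) ^ 2 + 2 * (F₂ x ^ 2 + F₃ x ^ 2)) := by
            gcongr; exact ENNReal.add_sq_le_two_mul _ _
        _ = _ := by ring
    calc _ ≤ ∫⁻ x in ball y (R / M), (8 * F₁ x ^ 2 + 4 * F₂ x ^ 2 + 4 * F₃ x ^ 2) :=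
          setLIntegral_mono' measurableSet_ball hpt
      _ = 8 * (∫⁻ x in ball y (R / M), F₁ x ^ 2) + 4 * (∫⁻ x in ball y (R / M), F₂ x ^ 2)
          + 4 * (∫⁻ x in ball y (R / M), F₃ x ^ 2) := by
          rw [lintegral_add_left (by fun_prop), lintegral_add_left (by fun_prop),
            lintegral_const_mul' _ _ (by norm_num), lintegral_const_mul' _ _ (by norm_num),
            lintegral_const_mul' _ _ (by norm_num)]
      _ ≤ 8 * _ + 4 * _ + 4 * _ :=
          add_le_add (add_le_add (mul_le_mul_right h₁ 8) (mul_le_mul_right h₂ 4))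
            (mul_le_mul_right h₃ 4)
      _ = _ := by push_cast; ring

/-- The global maximal estimate for frequencies comparable to `M`. It follows by integrating the
weighted local bounds over all centres `y`: both sides acquire the same factor `(R / M) ^ d`. -/
theorem IsLocalBound.exists_global (hC : IsLocalBound d α s C) (hs : 0 ≤ s) {ψ : Rd d → ℂ}
    (hψ : IsShellCutoff ψ) :
    ∃ C' : ℝ≥0, ∀ (M R : ℝ) (G : 𝓢(Rd d, ℂ)), 0 < M → 1 ≤ R →
      ∫⁻ x, maxFun α {t | t ≠ 0 ∧ |t| ≤ min R (R ^ α) * (M ^ α)⁻¹}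
        (fun ξ => ψ (M⁻¹ • ξ) * G ξ) x ^ 2 ≤
      C' * ENNReal.ofReal (R ^ (2 * s)) * ∫⁻ ξ, ‖G ξ‖ₑ ^ 2 := by
  obtain ⟨C', hC'⟩ := hC.exists_weighted hs (coordList d)
    (fun v hv => norm_le_one_of_mem_coordList hv) ψ hψ
  have hwm : Measurable fun z : Rd d => ENNReal.ofReal (decayWeight (coordList d) z) := by
    refine (continuous_list_prod _ fun v _ => ?_).measurable.ennreal_ofReal
    exact Continuous.inv₀ (by fun_prop) fun z => by positivity
  set W : ℝ≥0∞ := ∫⁻ z : Rd d, ENNReal.ofReal (decayWeight (coordList d) z) with hW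
  have hWtop : W ≠ ⊤ := integrable_decayWeight_coordList.lintegral_lt_top.ne
  set V : ℝ≥0∞ := volume (ball (0 : Rd d) 1) with hV
  have hV0 : V ≠ 0 := (measure_ball_pos _ _ one_pos).ne'
  have hVtop : V ≠ ⊤ := measure_ball_lt_top.ne
  refine ⟨C' * W.toNNReal * V.toNNReal⁻¹, fun M R G hM hR => ?_⟩
  have hR0 : 0 < R := by linarith
  set ρ := R / M with hρdef
  have hρ : 0 < ρ := by positivity
  set Θ : Set ℝ := {t | t ≠ 0 ∧ |t| ≤ min R (R ^ α) * (M ^ α)⁻¹} with hΘ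
  set F := maxFun α Θ (fun ξ => ψ (M⁻¹ • ξ) * G ξ) with hF
  have hFm : Measurable F := measurable_maxFun α Θ ((hψ.dilation hM).integrable_mul _)
  set f : 𝓢(Rd d, ℂ) := 𝓕⁻ G with hf
  have hfG : 𝓕 f = G := FourierTransform.fourier_fourierInv_eq G
  have hloc : ∀ y, ∫⁻ x in ball y ρ, F x ^ 2 ≤ C' * ENNReal.ofReal (R ^ (2 * s)) *
      ∫⁻ x, ENNReal.ofReal (decayWeight (coordList d) (ρ⁻¹ • (x - y))) * ‖f x‖ₑ ^ 2 := by
    intro y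
    obtain ⟨h, h1, h2⟩ := exists_foldr_weightMul_eq ρ y (coordList d) f
    have := hC' M R y h hM hR
    rw [h1, hfG] at this
    refine this.trans (le_of_eq ?_)
    congr 1
    refine lintegral_congr fun x => ?_
    rw [← ofReal_norm, ← ofReal_norm, ← ENNReal.ofReal_pow (norm_nonneg _),
      ← ENNReal.ofReal_pow (norm_nonneg _), ← ENNReal.ofReal_mul (decayWeight_nonneg _ _), h2]
  have hleft : ∫⁻ y, ∫⁻ x in ball y ρ, F x ^ 2 = ENNReal.ofReal (ρ ^ d) * V * ∫⁻ x, F x ^ 2 := by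
    have hm : Measurable (Function.uncurry fun y x : Rd d =>
        (ball y ρ).indicator (fun x => F x ^ 2) x) := by
      have : (Function.uncurry fun y x : Rd d => (ball y ρ).indicator (fun x => F x ^ 2) x) =
          {p : Rd d × Rd d | dist p.2 p.1 < ρ}.indicator fun p => F p.2 ^ 2 := by
        funext p; rfl
      rw [this]
      exact ((hFm.comp measurable_snd).pow_const 2).indicator
        (measurableSet_lt (by fun_prop) measurable_const)
    calc _ = ∫⁻ y, ∫⁻ x, (ball y ρ).indicator (fun x => F x ^ 2) x :=
          lintegral_congr fun y => (lintegral_indicator measurableSet_ball _).symm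
      _ = ∫⁻ x, ∫⁻ y, (ball y ρ).indicator (fun x => F x ^ 2) x :=
          lintegral_lintegral_swap hm.aemeasurable
      _ = ∫⁻ x, ENNReal.ofReal (ρ ^ d) * V * F x ^ 2 := by
          refine lintegral_congr fun x => ?_
          have : ∀ y, (ball y ρ).indicator (fun x => F x ^ 2) x =
              (ball x ρ).indicator (fun _ => F x ^ 2) y := by
            intro y
            by_cases hy : y ∈ ball x ρ
            · rw [indicator_of_mem hy, indicator_of_mem (mem_ball_comm.1 hy)]
            · rw [indicator_of_notMem hy, indicator_of_notMem (fun h => hy (mem_ball_comm.1 h))]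
          rw [lintegral_congr this, lintegral_indicator_const measurableSet_ball,
            Measure.addHaar_ball_of_pos _ _ hρ, finrank_euclideanSpace_fin, mul_comm]
      _ = _ := lintegral_const_mul' _ _ (ENNReal.mul_ne_top ENNReal.ofReal_ne_top hVtop)
  have hright : ∫⁻ y, ∫⁻ x,
        ENNReal.ofReal (decayWeight (coordList d) (ρ⁻¹ • (x - y))) * ‖f x‖ₑ ^ 2 =
      ENNReal.ofReal (ρ ^ d) * W * ∫⁻ x, ‖f x‖ₑ ^ 2 := by
    rw [lintegral_lintegral_swap (by
      have := f.continuous.measurable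
      exact ((hwm.comp (by fun_prop : Measurable fun p : Rd d × Rd d => ρ⁻¹ • (p.2 - p.1))).mul
        ((this.comp measurable_snd).enorm.pow_const 2)).aemeasurable)]
    rw [← lintegral_const_mul' _ _ (ENNReal.mul_ne_top ENNReal.ofReal_ne_top hWtop)]
    refine lintegral_congr fun x => ?_
    rw [lintegral_mul_const' _ _ (by simp)]
    congr 1
    rw [lintegral_sub_left_eq_self (fun z : Rd d =>
      ENNReal.ofReal (decayWeight (coordList d) (ρ⁻¹ • z))) x,
      lintegral_comp_smul_inv (fun z => ENNReal.ofReal (decayWeight (coordList d) z)) hρ]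
  have hfin := lintegral_mono (μ := (volume : Measure (Rd d))) hloc
  rw [hleft, lintegral_const_mul' _ _ (ENNReal.mul_ne_top ENNReal.coe_ne_top ENNReal.ofReal_ne_top),
    hright, ← lintegral_enorm_fourier_sq, hfG] at hfin
  have hρd : ENNReal.ofReal (ρ ^ d) ≠ 0 := by
    rw [Ne, ENNReal.ofReal_eq_zero, not_le]; positivity
  rw [ENNReal.coe_mul, ENNReal.coe_mul, 
    ENNReal.coe_inv (by simp [ENNReal.toNNReal_eq_zero_iff, hV0, hVtop]),
    ENNReal.coe_toNNReal hWtop, ENNReal.coe_toNNReal hVtop]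
  have h2 : ENNReal.ofReal (ρ ^ d) * (V * ∫⁻ x, F x ^ 2) ≤ ENNReal.ofReal (ρ ^ d) *
      (C' * W * ENNReal.ofReal (R ^ (2 * s)) * ∫⁻ ξ, ‖G ξ‖ₑ ^ 2) := by
    refine le_trans (le_of_eq (by ring)) (hfin.trans (le_of_eq (by ring)))
  rw [ENNReal.mul_le_mul_iff_right hρd ENNReal.ofReal_ne_top] at h2
  calc ∫⁻ x, F x ^ 2 = V⁻¹ * (V * ∫⁻ x, F x ^ 2) := by
        rw [← mul_assoc, ENNReal.inv_mul_cancel hV0 hVtop, one_mul]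
    _ ≤ V⁻¹ * (C' * W * ENNReal.ofReal (R ^ (2 * s)) * ∫⁻ ξ, ‖G ξ‖ₑ ^ 2) := mul_le_mul_right h2 _
    _ = _ := by ring

end Weighted

/-! ### Maximal estimates for square integrable profiles -/

section SquareIntegrable
open Filter Topology
variable {d : ℕ} {α s : ℝ} {C : ℝ≥0}

/-- A maximal bound for profiles `χ G`, `G` Schwartz, passes to profiles `χ w` with `w ∈ L²`, along
countably many times. -/
theorem lintegral_iSup_evol_le {B : Set (Rd d)} {Θ : Set ℝ} {χ : Rd d → ℂ}
    (hχ : χ.HasTemperateGrowth) {A : ℝ} (hA : ∀ ξ, ‖χ ξ‖ ≤ A) {b : ℝ≥0∞} (hb : b ≠ ∞)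
    (h : ∀ G : 𝓢(Rd d, ℂ),
      ∫⁻ x in B, maxFun α Θ (fun ξ => χ ξ * G ξ) x ^ 2 ≤ b * ∫⁻ ξ, ‖G ξ‖ₑ ^ 2)
    {g w : L2Rd d} (hg : ∀ᵐ ξ, g ξ = χ ξ * w ξ) {τ : ℕ → ℝ} {S : Set ℕ} (hS : ∀ n ∈ S, τ n ∈ Θ) :
    ∫⁻ x in B, (⨆ n ∈ S, ‖evol α (τ n) g x‖ₑ) ^ 2 ≤ b * ∫⁻ ξ, ‖w ξ‖ₑ ^ 2 := by
  obtain ⟨u, hu, hlim⟩ := mem_closure_iff_seq_limit.1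
    ((SchwartzMap.denseRange_toLpCLM (E := Rd d) (F := ℂ) (p := 2) (μ := volume)
      (by norm_num)).closure_range ▸ mem_univ w)
  choose G hG using hu
  have hGu : ∀ k, ((G k).toLp 2 volume : L2Rd d) = u k := hG
  have hl : Tendsto (fun k => ((smulLeftCLM ℂ χ (G k)).toLp 2 volume : L2Rd d)) atTop (𝓝 g) := by
    rw [tendsto_iff_norm_sub_tendsto_zero]
    have h0 : Tendsto (fun k => A * ‖u k - w‖) atTop (𝓝 0) := by
      simpa using (tendsto_iff_norm_sub_tendsto_zero.1 hlim).const_mul A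
    refine squeeze_zero (fun k => norm_nonneg _) (fun k => ?_) h0
    refine Lp.norm_le_mul_norm_of_ae_le_mul ?_
    rw [← hGu k]
    filter_upwards [hg, (smulLeftCLM ℂ χ (G k)).coeFn_toLp 2 volume, (G k).coeFn_toLp 2 volume,
      Lp.coeFn_sub ((smulLeftCLM ℂ χ (G k)).toLp 2 volume) g,
      Lp.coeFn_sub ((G k).toLp 2 volume) w] with ξ h1 h2 h3 h4 h5
    rw [h4, h5, Pi.sub_apply, Pi.sub_apply, h1, h2, h3, smulLeftCLM_apply_apply hχ, smul_eq_mul,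
      ← mul_sub, norm_mul]
    exact mul_le_mul_of_nonneg_right (hA ξ) (norm_nonneg _)
  refine lintegral_iSup_evol_le_of_tendsto hl hS (b := fun k => b * ‖u k‖ₑ ^ 2) ?_ fun k => ?_
  · rw [lintegral_enorm_sq_eq]
    have hl2 : Tendsto (fun k => ‖u k‖ₑ ^ 2) atTop (𝓝 (‖w‖ₑ ^ 2)) := by
      simpa using hlim.enorm.ennrpow_const 2
    exact ENNReal.Tendsto.const_mul hl2 (Or.inr hb)
  · have := h (G k)
    rw [lintegral_enorm_toLp_sq, hGu] at this
    convert this using 5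
    funext ξ
    rw [smulLeftCLM_apply_apply hχ, smul_eq_mul]

theorem exists_ball_cutoff (d : ℕ) : ∃ χ : Rd d → ℂ, ContDiff ℝ ((⊤ : ℕ∞) : WithTop ℕ∞) χ ∧
    HasCompactSupport χ ∧ ∀ ξ, ‖ξ‖ ≤ 1 → χ ξ = 1 := by
  let f : ContDiffBump (0 : Rd d) := ⟨1, 2, by norm_num, by norm_num⟩
  refine ⟨fun ξ => (f ξ : ℂ), Complex.ofRealCLM.contDiff.comp f.contDiff,
    f.hasCompactSupport.comp_left (g := Complex.ofReal) rfl, fun ξ hξ => ?_⟩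
  beta_reduce
  rw [f.one_of_mem_closedBall (by simpa using hξ), Complex.ofReal_one]

theorem exists_isShellCutoff (d : ℕ) : ∃ ψ : Rd d → ℂ, IsShellCutoff ψ ∧
    ∀ ξ, 1 / 2 ≤ ‖ξ‖ → ‖ξ‖ ≤ 1 → ψ ξ = 1 := by
  let f : ContDiffBump (0 : Rd d) := ⟨1, 2, by norm_num, by norm_num⟩
  let g : ContDiffBump (0 : Rd d) := ⟨1 / 4, 1 / 2, by norm_num, by norm_num⟩
  refine ⟨fun ξ => ((f ξ - g ξ : ℝ) : ℂ), ⟨?_, ?_, ?_⟩, fun ξ h1 h2 => ?_⟩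
  · exact Complex.ofRealCLM.contDiff.comp (f.contDiff.sub g.contDiff)
  · exact (f.hasCompactSupport.sub g.hasCompactSupport).comp_left (g := Complex.ofReal) rfl
  · rw [notMem_tsupport_iff_eventuallyEq]
    filter_upwards [f.eventuallyEq_one, g.eventuallyEq_one] with ξ h1 h2
    simp [h1, h2]
  · beta_reduce
    rw [f.one_of_mem_closedBall (by simpa using h2),
      g.zero_of_le_dist (by rw [dist_zero_right]; exact h1)]
    simp

/-- The global maximal estimate for `L²` profiles supported in the shell `M / 2 ≤ |ξ| ≤ M`, along
times up to `T M ^ (-α)`. -/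
theorem IsLocalBound.exists_shell (hC : IsLocalBound d α s C) (hs : 0 ≤ s) (hα : 0 < α) :
    ∃ C' : ℝ≥0, ∀ (M T : ℝ) (g : L2Rd d) (τ : ℕ → ℝ) (S : Set ℕ), 0 < M → 1 ≤ T →
      (∀ᵐ ξ, g ξ ≠ 0 → M / 2 ≤ ‖ξ‖ ∧ ‖ξ‖ ≤ M) →
      (∀ n ∈ S, τ n ≠ 0 ∧ |τ n| ≤ T * (M ^ α)⁻¹) →
      ∫⁻ x, (⨆ n ∈ S, ‖evol α (τ n) g x‖ₑ) ^ 2 ≤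
        C' * ENNReal.ofReal (T ^ (2 * (s / min α 1))) * ∫⁻ ξ, ‖g ξ‖ₑ ^ 2 := by
  obtain ⟨ψ, hψ, hψ1⟩ := exists_isShellCutoff d
  obtain ⟨C', hC'⟩ := hC.exists_global hs hψ
  obtain ⟨A, hA⟩ := hψ.contDiff.continuous.bounded_above_of_compact_support hψ.hasCompactSupport
  refine ⟨C', fun M T g τ S hM hT hg hS => ?_⟩
  have hm : 0 < min α 1 := lt_min hα one_pos
  have hT0 : 0 < T := by linarith
  -- the smallest `R` with `T ≤ min R (R ^ α)`
  set R : ℝ := T ^ (min α 1)⁻¹ with hRdef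
  have hR : 1 ≤ R := Real.one_le_rpow hT (by positivity)
  have hRm : R ^ min α 1 = T := by
    rw [hRdef, ← Real.rpow_mul hT0.le, inv_mul_cancel₀ hm.ne', Real.rpow_one]
  have hTR : T ≤ min R (R ^ α) := by
    rw [← hRm]
    refine le_min ?_ (Real.rpow_le_rpow_of_exponent_le hR (min_le_left _ _))
    exact (Real.rpow_le_rpow_of_exponent_le hR (min_le_right _ _)).trans (Real.rpow_one R).le
  have hRs : R ^ (2 * s) = T ^ (2 * (s / min α 1)) := by
    rw [hRdef, ← Real.rpow_mul hT0.le]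
    congr 1; field_simp
  rw [← setLIntegral_univ, ← hRs]
  refine lintegral_iSup_evol_le (hψ.dilation hM).hasTemperateGrowth (fun ξ => hA _)
    (ENNReal.mul_ne_top ENNReal.coe_ne_top ENNReal.ofReal_ne_top)
    (fun G => by rw [setLIntegral_univ]; exact hC' M R G hM hR) ?_ (fun n hn => ?_)
  · filter_upwards [hg] with ξ hξ
    by_cases h0 : g ξ = 0
    · simp [h0]
    · obtain ⟨h1, h2⟩ := hξ h0
      have hn : ‖M⁻¹ • ξ‖ = ‖ξ‖ / M := by
        rw [norm_smul, Real.norm_of_nonneg (by positivity), div_eq_inv_mul]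
      rw [hψ1, one_mul]
      · rw [hn, le_div_iff₀ hM]; linarith
      · rw [hn, div_le_one hM]; exact h2
  · exact ⟨(hS n hn).1, (hS n hn).2.trans (by gcongr)⟩

/-- The local bound for low frequencies, where the Sobolev weight is bounded. -/
theorem IsLocalBound.exists_lowFrequency (hC : IsLocalBound d α s C) :
    ∃ C' : ℝ≥0, ∀ (g : L2Rd d) (τ : ℕ → ℝ) (S : Set ℕ),
      (∀ᵐ ξ, g ξ ≠ 0 → ‖ξ‖ ≤ 1) → (∀ n ∈ S, τ n ≠ 0 ∧ |τ n| ≤ 1) →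
      ∫⁻ x in ball 0 1, (⨆ n ∈ S, ‖evol α (τ n) g x‖ₑ) ^ 2 ≤ C' * ∫⁻ ξ, ‖g ξ‖ₑ ^ 2 := by
  obtain ⟨χ, hχ, hχc, hχ1⟩ := exists_ball_cutoff d
  have hχt := hχc.hasTemperateGrowth hχ
  obtain ⟨A, hA⟩ := hχ.continuous.bounded_above_of_compact_support hχc
  have hcont : Continuous fun ζ : Rd d => ((sobolevWeight s ζ : ℝ) : ℂ) * (χ ζ) ^ 2 := by
    have := hχ.continuous
    have h2 : Continuous (sobolevWeight (d := d) s) :=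
      Continuous.rpow_const (by fun_prop) fun ζ => Or.inl (by positivity)
    fun_prop
  have hsupp : HasCompactSupport fun ζ : Rd d => ((sobolevWeight s ζ : ℝ) : ℂ) * (χ ζ) ^ 2 := by
    simp only [pow_two]
    exact (hχc.mul_left).mul_left
  obtain ⟨D, hD⟩ := hcont.bounded_above_of_compact_support hsupp
  refine ⟨C * D.toNNReal, fun g τ S hg hS => ?_⟩
  refine lintegral_iSup_evol_le (Θ := {t | t ≠ 0 ∧ |t| ≤ 1}) hχt hA ENNReal.coe_ne_top
    (fun G => ?_) ?_ hS
  · have hK : (fun ξ => χ ξ * G ξ) = smulLeftCLM ℂ χ G := by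
      funext ξ; rw [smulLeftCLM_apply_apply hχt]; rfl
    rw [hK]
    refine (hC _).trans ?_
    rw [ENNReal.coe_mul, mul_assoc, ← lintegral_const_mul' (D.toNNReal : ℝ≥0∞) _ ENNReal.coe_ne_top]
    refine mul_le_mul_right (lintegral_mono fun ξ => ?_) _
    have hw : 0 ≤ sobolevWeight s ξ := by unfold sobolevWeight; positivity
    have h2 := hD ξ
    rw [norm_mul, Complex.norm_real, Real.norm_of_nonneg hw, norm_pow] at h2
    rw [smulLeftCLM_apply_apply hχt, smul_eq_mul, enorm_mul, mul_pow, ← mul_assoc]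
    refine mul_le_mul_left ?_ _
    rw [← ofReal_norm, ← ENNReal.ofReal_pow (norm_nonneg _), ← ENNReal.ofReal_mul hw]
    exact ENNReal.ofReal_le_ofReal h2
  · filter_upwards [hg] with ξ hξ
    by_cases h0 : g ξ = 0
    · simp [h0]
    · rw [hχ1 ξ (hξ h0), one_mul]

/-- The local bound for all profiles of finite Sobolev norm, along countably many times: apply the
density argument with the multiplier `sobolevWeight (-(s / 2))`. -/
theorem IsLocalBound.lintegral_iSup_le (hC : IsLocalBound d α s C) (hs : 0 ≤ s) (g : L2Rd d)
    (hg : ∫⁻ ξ, ENNReal.ofReal (sobolevWeight s ξ) * ‖g ξ‖ₑ ^ 2 ≠ ∞)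
    (τ : ℕ → ℝ) (S : Set ℕ) (hS : ∀ n ∈ S, τ n ≠ 0 ∧ |τ n| ≤ 1) :
    ∫⁻ x in ball 0 1, (⨆ n ∈ S, ‖evol α (τ n) g x‖ₑ) ^ 2 ≤
      C * ∫⁻ ξ, ENNReal.ofReal (sobolevWeight s ξ) * ‖g ξ‖ₑ ^ 2 := by
  set b : Rd d → ℝ := sobolevWeight (-(s / 2)) with hb
  have hb0 : ∀ ξ, 0 < b ξ := fun ξ => by rw [hb]; unfold sobolevWeight; positivity
  have hb2 : ∀ ξ, sobolevWeight s ξ = ((b ξ)⁻¹) ^ 2 := fun ξ => by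
    rw [hb]; unfold sobolevWeight
    rw [← Real.rpow_neg (by positivity), neg_neg, ← Real.rpow_mul_natCast (by positivity)]
    congr 1; push_cast; ring
  have hχt : (fun ξ => ((b ξ : ℝ) : ℂ)).HasTemperateGrowth := by
    have h1 := Function.hasTemperateGrowth_one_add_norm_sq_rpow (Rd d) (-(s / 2))
    have h2 : (fun ξ : Rd d => (2 * Real.pi) • ξ).HasTemperateGrowth := by fun_prop
    have h3 := h1.comp h2
    have h4 : b = (fun x : Rd d => (1 + ‖x‖ ^ 2) ^ (-(s / 2))) ∘ fun ξ => (2 * Real.pi) • ξ := by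
      funext ξ
      rw [Function.comp_apply, norm_smul, Real.norm_of_nonneg (by positivity)]
      rfl
    rw [← h4] at h3
    fun_prop
  have hbc : Continuous b := by
    rw [hb]
    exact Continuous.rpow_const (by fun_prop) fun ζ => Or.inl (by positivity)
  have hsq : ∀ ξ, ‖((b ξ)⁻¹ : ℂ) * g ξ‖ₑ ^ 2 = ENNReal.ofReal (sobolevWeight s ξ) * ‖g ξ‖ₑ ^ 2 := by
    intro ξ
    rw [enorm_mul, mul_pow, hb2, ENNReal.ofReal_pow (by have := hb0 ξ; positivity), ← ofReal_norm,
      norm_inv, Complex.norm_real, Real.norm_of_nonneg (hb0 ξ).le]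
  have hmem : MemLp (fun ξ => ((b ξ)⁻¹ : ℂ) * g ξ) 2 volume := by
    refine ⟨?_, ?_⟩
    · have := hbc.measurable
      exact (Measurable.inv (by fun_prop)).aestronglyMeasurable.mul
        (Lp.aestronglyMeasurable g)
    · rw [lt_top_iff_ne_top]
      intro htop
      have := eLpNorm_two_sq volume (fun ξ => ((b ξ)⁻¹ : ℂ) * g ξ)
      rw [htop, lintegral_congr hsq] at this
      exact hg (by rw [← this]; simp)
  have hw := hmem.coeFn_toLp
  have hR : ∫⁻ ξ, ‖hmem.toLp _ ξ‖ₑ ^ 2 =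
      ∫⁻ ξ, ENNReal.ofReal (sobolevWeight s ξ) * ‖g ξ‖ₑ ^ 2 := by
    refine lintegral_congr_ae ?_
    filter_upwards [hw] with ξ hξ
    rw [hξ, hsq]
  rw [← hR]
  refine lintegral_iSup_evol_le (Θ := {t | t ≠ 0 ∧ |t| ≤ 1}) hχt (A := 1) (fun ξ => ?_)
    ENNReal.coe_ne_top (fun G => ?_) ?_ hS
  · rw [Complex.norm_real, Real.norm_of_nonneg (hb0 ξ).le, hb]
    unfold sobolevWeight
    exact Real.rpow_le_one_of_one_le_of_nonpos (by nlinarith [sq_nonneg (2 * Real.pi * ‖ξ‖)])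
      (by linarith)
  · have hK : (fun ξ => (b ξ : ℂ) * G ξ) = smulLeftCLM ℂ (fun ξ => ((b ξ : ℝ) : ℂ)) G := by
      funext ξ; rw [smulLeftCLM_apply_apply hχt]; rfl
    rw [hK]
    refine (hC _).trans (le_of_eq ?_)
    congr 1
    refine lintegral_congr fun ξ => ?_
    rw [← hK, enorm_mul, mul_pow, ← mul_assoc, hb2, ← ofReal_norm, Complex.norm_real,
      Real.norm_of_nonneg (hb0 ξ).le, ← ENNReal.ofReal_pow (hb0 ξ).le,
      ← ENNReal.ofReal_mul (by positivity), ← mul_pow, inv_mul_cancel₀ (hb0 ξ).ne']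
    simp
  · filter_upwards [hw] with ξ hξ
    have : (b ξ : ℂ) ≠ 0 := by exact_mod_cast (hb0 ξ).ne'
    rw [hξ, mul_inv_cancel_left₀ this]

end SquareIntegrable

/-! ### Dyadic decomposition in frequency -/

section Dyadic
variable {d : ℕ} {α : ℝ}

/-- The sharp frequency cutoff of `g ∈ L²` to the set `A`. -/
def freqCut (A : Set (Rd d)) (hA : MeasurableSet A) (g : L2Rd d) : L2Rd d :=
  ((Lp.memLp g).indicator hA).toLp _

theorem freqCut_ae_eq {A : Set (Rd d)} (hA : MeasurableSet A) (g : L2Rd d) :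
    freqCut A hA g =ᵐ[volume] A.indicator g :=
  ((Lp.memLp g).indicator hA).coeFn_toLp

theorem lintegral_freqCut_sq {A : Set (Rd d)} (hA : MeasurableSet A) (g : L2Rd d) :
    ∫⁻ ξ, ‖freqCut A hA g ξ‖ₑ ^ 2 = ∫⁻ ξ in A, ‖g ξ‖ₑ ^ 2 := by
  rw [← lintegral_indicator hA]
  refine lintegral_congr_ae ?_
  filter_upwards [freqCut_ae_eq hA g] with ξ hξ
  rw [hξ]
  by_cases h : ξ ∈ A <;> simp [h]

theorem freqCut_union {A B : Set (Rd d)} (hA : MeasurableSet A) (hB : MeasurableSet B)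
    (hAB : Disjoint A B) (g : L2Rd d) :
    freqCut (A ∪ B) (hA.union hB) g = freqCut A hA g + freqCut B hB g := by
  refine Lp.ext ?_
  filter_upwards [freqCut_ae_eq hA g, freqCut_ae_eq hB g, freqCut_ae_eq (hA.union hB) g,
    Lp.coeFn_add (freqCut A hA g) (freqCut B hB g)] with ξ h1 h2 h3 h4
  rw [h4, h3, Pi.add_apply, h1, h2, indicator_union_of_disjoint hAB]

/-- The radii `0, 1, 2, 4, …` of the dyadic decomposition. The first shell is the unit ball. -/
def dyadicRadius : ℕ → ℝ
  | 0 => 0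
  | k + 1 => 2 ^ k

theorem dyadicRadius_mono : Monotone dyadicRadius := by
  refine monotone_nat_of_le_succ fun k => ?_
  cases k with
  | zero => simp [dyadicRadius]
  | succ k => exact pow_le_pow_right₀ one_le_two k.le_succ

/-- The frequencies from the `N`-th dyadic radius on. -/
def freqTail (d N : ℕ) : Set (Rd d) := {ξ | dyadicRadius N ≤ ‖ξ‖}

/-- The `k`-th dyadic shell of frequencies, `2 ^ (k - 1) ≤ |ξ| < 2 ^ k` for `k ≥ 1`. -/
def freqShell (d k : ℕ) : Set (Rd d) := {ξ | dyadicRadius k ≤ ‖ξ‖ ∧ ‖ξ‖ < dyadicRadius (k + 1)}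

theorem measurableSet_freqTail (d N : ℕ) : MeasurableSet (freqTail d N) :=
  measurableSet_le measurable_const measurable_norm

theorem measurableSet_freqShell (d k : ℕ) : MeasurableSet (freqShell d k) :=
  (measurableSet_le measurable_const measurable_norm).inter
    (measurableSet_lt measurable_norm measurable_const)

theorem freqTail_eq_union (d N : ℕ) : freqTail d N = freqShell d N ∪ freqTail d (N + 1) := by
  ext ξ
  have := dyadicRadius_mono N.le_succ
  simp only [freqTail, freqShell, mem_ofPred_eq, mem_union]
  constructor
  · intro h
    rcases lt_or_ge ‖ξ‖ (dyadicRadius (N + 1)) with h' | h'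
    exacts [Or.inl ⟨h, h'⟩, Or.inr h']
  · rintro (h | h)
    exacts [h.1, this.trans h]

theorem disjoint_freqShell_freqTail (d N : ℕ) :
    Disjoint (freqShell d N) (freqTail d (N + 1)) :=
  disjoint_left.2 fun _ h h' => not_le_of_gt h.2 h'

theorem pairwise_disjoint_freqShell (d : ℕ) : Pairwise (Function.onFun Disjoint (freqShell d)) := by
  refine (pairwise_disjoint_on _).2 fun m n hmn => disjoint_left.2 fun ξ h h' => ?_
  exact not_le_of_gt h.2 ((dyadicRadius_mono hmn).trans h'.1)

theorem two_pow_sq_le_of_mem_freqTail {k : ℕ} {ξ : Rd d} (h : ξ ∈ freqTail d k) :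
    ((2 : ℝ) ^ k) ^ 2 ≤ 1 + (2 * Real.pi * ‖ξ‖) ^ 2 := by
  cases k with
  | zero => simp; positivity
  | succ k =>
    have h1 : (2 : ℝ) ^ k ≤ ‖ξ‖ := h
    have h2 : (2 : ℝ) ^ (k + 1) ≤ 2 * Real.pi * ‖ξ‖ := by
      rw [pow_succ, mul_comm]
      exact mul_le_mul (by linarith [Real.pi_gt_three]) h1 (by positivity) (by positivity)
    have := pow_le_pow_left₀ (by positivity) h2 2
    linarith

theorem evol_ae_eq_sum_shells (t : ℝ) (g : L2Rd d) (N : ℕ) :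
    ∀ᵐ x, evol α t g x =
      ∑ k ∈ Finset.range N, evol α t (freqCut (freqShell d k) (measurableSet_freqShell d k) g) x
      + evol α t (freqCut (freqTail d N) (measurableSet_freqTail d N) g) x := by
  induction N with
  | zero =>
    have : freqCut (freqTail d 0) (measurableSet_freqTail d 0) g = g := by
      refine Lp.ext ?_
      filter_upwards [freqCut_ae_eq (measurableSet_freqTail d 0) g] with ξ hξ
      rw [hξ, indicator_of_mem]
      exact norm_nonneg ξ
    filter_upwards with x
    simp [this]
  | succ N ih =>
    have h1 : freqCut (freqTail d N) (measurableSet_freqTail d N) g =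
        freqCut (freqShell d N) (measurableSet_freqShell d N) g +
        freqCut (freqTail d (N + 1)) (measurableSet_freqTail d (N + 1)) g := by
      rw [← freqCut_union _ _ (disjoint_freqShell_freqTail d N)]
      congr 1
      exact freqTail_eq_union d N
    filter_upwards [ih, Lp.coeFn_add
      (evol α t (freqCut (freqShell d N) (measurableSet_freqShell d N) g))
      (evol α t (freqCut (freqTail d (N + 1)) (measurableSet_freqTail d (N + 1)) g))] with x h2 h3
    rw [h2, h1, evol_add, h3, Finset.sum_range_succ, Pi.add_apply, add_assoc]

theorem ofReal_two_rpow_le_of_mem_freqTail {σ : ℝ} (hσ : 0 ≤ σ) {k : ℕ} {ξ : Rd d}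
    (h : ξ ∈ freqTail d k) :
    (2 : ℝ≥0∞) ^ (2 * k * σ : ℝ) ≤ ENNReal.ofReal (sobolevWeight σ ξ) := by
  have h1 := Real.rpow_le_rpow (by positivity) (two_pow_sq_le_of_mem_freqTail h) hσ
  have h2 : (2 : ℝ≥0∞) ^ (2 * k * σ : ℝ) = ENNReal.ofReal ((((2 : ℝ) ^ k) ^ 2) ^ σ) := by
    rw [← pow_mul, ← Real.rpow_natCast, ← Real.rpow_mul (by positivity),
      ← ENNReal.ofReal_rpow_of_pos two_pos, ENNReal.ofReal_ofNat]
    congr 1; push_cast; ring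
  rw [h2]
  exact ENNReal.ofReal_le_ofReal h1

theorem tsum_shell_energy_le {σ : ℝ} (hσ : 0 ≤ σ) (g : L2Rd d) :
    ∑' k : ℕ, (2 : ℝ≥0∞) ^ (2 * k * σ : ℝ) *
        ∫⁻ ξ, ‖freqCut (freqShell d k) (measurableSet_freqShell d k) g ξ‖ₑ ^ 2 ≤
      ∫⁻ ξ, ENNReal.ofReal (sobolevWeight σ ξ) * ‖g ξ‖ₑ ^ 2 := by
  calc _ ≤ ∑' k : ℕ, ∫⁻ ξ in freqShell d k, ENNReal.ofReal (sobolevWeight σ ξ) * ‖g ξ‖ₑ ^ 2 := by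
        refine ENNReal.tsum_le_tsum fun k => ?_
        rw [lintegral_freqCut_sq, ← lintegral_const_mul' _ _ (by simp)]
        refine setLIntegral_mono' (measurableSet_freqShell d k) fun ξ hξ => ?_
        exact mul_le_mul_left
          (ofReal_two_rpow_le_of_mem_freqTail hσ (show ξ ∈ freqTail d k from hξ.1)) _
    _ = ∫⁻ ξ in ⋃ k, freqShell d k, ENNReal.ofReal (sobolevWeight σ ξ) * ‖g ξ‖ₑ ^ 2 :=
        (lintegral_iUnion (measurableSet_freqShell d) (pairwise_disjoint_freqShell d) _).symm
    _ ≤ _ := setLIntegral_le_lintegral _ _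

theorem MemWeakEll.exists_encard_le {r : ℝ} {t : ℕ → ℝ} (ht : MemWeakEll r t) :
    ∃ K : ℝ≥0, ∀ δ : ℝ, 0 < δ →
      (({n : ℕ | δ ≤ |t n|}.encard : ℕ∞) : ℝ≥0∞) ≤ K * ENNReal.ofReal (δ ^ (-r)) := by
  unfold MemWeakEll at ht
  refine ⟨(⨆ δ ∈ Ioi (0 : ℝ),
    ENNReal.ofReal (δ ^ r) * (({n : ℕ | δ ≤ |t n|}.encard : ℕ∞) : ℝ≥0∞)).toNNReal, fun δ hδ => ?_⟩
  rw [ENNReal.coe_toNNReal ht.ne]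
  have h1 := le_iSup₂ (f := fun (δ : ℝ) (_ : δ ∈ Ioi (0 : ℝ)) =>
    ENNReal.ofReal (δ ^ r) * (({n : ℕ | δ ≤ |t n|}.encard : ℕ∞) : ℝ≥0∞)) δ hδ
  have h2 : ENNReal.ofReal (δ ^ (-r)) * ENNReal.ofReal (δ ^ r) = 1 := by
    rw [← ENNReal.ofReal_mul (by positivity), ← Real.rpow_add hδ, neg_add_cancel, Real.rpow_zero,
      ENNReal.ofReal_one]
  calc _ = ENNReal.ofReal (δ ^ (-r)) * (ENNReal.ofReal (δ ^ r) *
        (({n : ℕ | δ ≤ |t n|}.encard : ℕ∞) : ℝ≥0∞)) := by rw [← mul_assoc, h2, one_mul]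
    _ ≤ _ := mul_le_mul_right h1 _
    _ = _ := mul_comm _ _

/-- The frequency tails, started at a frequency tied to `|t n|` by `2 ^ (-N q) ≤ |t n|`, have
summable energy: the number of `n` whose tail contains `ξ` is at most a constant times the Sobolev
weight at `ξ`, by the weak `ℓ^r` bound. -/
theorem tsum_tail_energy_le {r q σ : ℝ} (hq : 0 ≤ q) (hqr : q * r = 2 * σ) {t : ℕ → ℝ}
    {K : ℝ≥0} (hK : ∀ δ : ℝ, 0 < δ →
      (({n : ℕ | δ ≤ |t n|}.encard : ℕ∞) : ℝ≥0∞) ≤ K * ENNReal.ofReal (δ ^ (-r)))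
    {S : Set ℕ} {N : ℕ → ℕ} (hN : ∀ n ∈ S, (2 : ℝ) ^ (-(N n * q) : ℝ) ≤ |t n|) (g : L2Rd d) :
    ∑' n : S, ∫⁻ ξ, ‖freqCut (freqTail d (N n)) (measurableSet_freqTail d (N n)) g ξ‖ₑ ^ 2 ≤
      K * ∫⁻ ξ, ENNReal.ofReal (sobolevWeight σ ξ) * ‖g ξ‖ₑ ^ 2 := by
  have hgm : Measurable fun ξ => ‖g ξ‖ₑ ^ 2 :=
    (Lp.stronglyMeasurable g).measurable.enorm.pow_const 2
  have hind : ∀ n : S, ∫⁻ ξ, ‖freqCut (freqTail d (N n)) (measurableSet_freqTail d (N n)) g ξ‖ₑ ^ 2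
      = ∫⁻ ξ, (freqTail d (N n)).indicator 1 ξ * ‖g ξ‖ₑ ^ 2 := by
    intro n
    rw [lintegral_freqCut_sq, ← lintegral_indicator (measurableSet_freqTail d (N n))]
    refine lintegral_congr fun ξ => ?_
    by_cases h : ξ ∈ freqTail d (N n) <;> simp [h]
  have hm : ∀ n : S, Measurable fun ξ : Rd d => (freqTail d (N n)).indicator 1 ξ * ‖g ξ‖ₑ ^ 2 :=
    fun n => (measurable_one.indicator (measurableSet_freqTail d (N n))).mul hgm
  rw [tsum_congr hind, ← lintegral_tsum fun n => (hm n).aemeasurable,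
    ← lintegral_const_mul' _ _ ENNReal.coe_ne_top]
  refine lintegral_mono fun ξ => ?_
  rw [ENNReal.tsum_mul_right, ← mul_assoc]
  refine mul_le_mul_left ?_ _
  set w : ℝ := 1 + (2 * Real.pi * ‖ξ‖) ^ 2 with hw
  have hw0 : 0 < w := by positivity
  -- every `n` whose tail contains `ξ` has `|t n| ≥ w ^ (-q/2)`
  have hcount := hK (w ^ (-(q / 2))) (by positivity)
  have hwσ : (w ^ (-(q / 2))) ^ (-r) = sobolevWeight σ ξ := by
    rw [← Real.rpow_mul hw0.le, sobolevWeight]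
    congr 1; linear_combination hqr / 2
  rw [hwσ] at hcount
  refine le_trans ?_ hcount
  have hsub : ∀ n : S, (freqTail d (N n)).indicator (1 : Rd d → ℝ≥0∞) ξ ≤
      {n : ℕ | w ^ (-(q / 2)) ≤ |t n|}.indicator (fun _ => 1) (n : ℕ) := by
    intro n
    by_cases h : ξ ∈ freqTail d (N n)
    · have hmem : (n : ℕ) ∈ {n : ℕ | w ^ (-(q / 2)) ≤ |t n|} := by
        refine le_trans ?_ (hN n n.2)
        have e : (2 : ℝ) ^ (-(N n * q) : ℝ) = (((2 : ℝ) ^ (N n)) ^ 2) ^ (-(q / 2)) := by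
          rw [← pow_mul, ← Real.rpow_natCast, ← Real.rpow_mul (by positivity)]
          congr 1; push_cast; ring
        rw [e]
        exact Real.rpow_le_rpow_of_nonpos (by positivity) (two_pow_sq_le_of_mem_freqTail h)
          (by linarith)
      rw [indicator_of_mem h, indicator_of_mem hmem]; rfl
    · rw [indicator_of_notMem h]; exact zero_le
  calc _ ≤ ∑' n : S, {n : ℕ | w ^ (-(q / 2)) ≤ |t n|}.indicator (fun _ => (1 : ℝ≥0∞)) (n : ℕ) :=
        ENNReal.tsum_le_tsum hsub
    _ ≤ ∑' n : ℕ, {n : ℕ | w ^ (-(q / 2)) ≤ |t n|}.indicator (fun _ => (1 : ℝ≥0∞)) n :=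
        ENNReal.tsum_comp_le_tsum_of_injective Subtype.val_injective _
    _ = _ := by
        rw [← tsum_subtype, ENNReal.tsum_set_one]

end Dyadic

/-! ### Summation over the dyadic shells -/

section Sequential
variable {d : ℕ} {α s : ℝ} {C : ℝ≥0} {t : ℕ → ℝ}

/-- The part of `g` with frequencies in the `k`-th dyadic shell. -/
def shellPart (k : ℕ) (g : L2Rd d) : L2Rd d :=
  freqCut (freqShell d k) (measurableSet_freqShell d k) g

theorem measurable_iSup_evol (α : ℝ) (t : ℕ → ℝ) (S : Set ℕ) (g : L2Rd d) :
    Measurable fun x => ⨆ n ∈ S, ‖evol α (t n) g x‖ₑ :=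
  Measurable.biSup _ (to_countable _) fun n _ => 
    (Lp.stronglyMeasurable (evol α (t n) g)).measurable.enorm

theorem enorm_evol_le_iSup {S : Set ℕ} {n : ℕ} (hn : n ∈ S) (g : L2Rd d) (x : Rd d) :
    ‖evol α (t n) g x‖ₑ ≤ ⨆ m ∈ S, ‖evol α (t m) g x‖ₑ :=
  le_iSup₂ (f := fun m (_ : m ∈ S) => ‖evol α (t m) g x‖ₑ) n hn

theorem shellPart_support (k : ℕ) (g : L2Rd d) :
    ∀ᵐ ξ, shellPart k g ξ ≠ 0 → ξ ∈ freqShell d k := by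
  filter_upwards [freqCut_ae_eq (measurableSet_freqShell d k) g] with ξ hξ h0
  by_contra h
  exact h0 (by rw [shellPart, hξ, indicator_of_notMem h])

/-- The indices of the short nonzero times at frequency `2 ^ k`, those with
`0 < |t n| ≤ 2 ^ (-k α)`. -/
def shortTimes (α : ℝ) (t : ℕ → ℝ) (k : ℕ) : Set ℕ :=
  {n | t n ≠ 0 ∧ |t n| ≤ 2 ^ (-(k * α) : ℝ)}

/-- The indices of the long times at frequency `2 ^ k` with `|t n| < 2 ^ (-(k + i) q)`. -/
def longTimes (α q : ℝ) (t : ℕ → ℝ) (k i : ℕ) : Set ℕ :=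
  {n | 2 ^ (-(k * α) : ℝ) < |t n| ∧ |t n| < 2 ^ (-((k + i : ℕ) * q) : ℝ)}

theorem two_pow_rpow_inv (k : ℕ) (α : ℝ) : (((2 : ℝ) ^ k) ^ α)⁻¹ = 2 ^ (-(k * α) : ℝ) := by
  rw [← Real.rpow_natCast, ← Real.rpow_mul (by norm_num), ← Real.rpow_neg (by norm_num)]

/-- The maximal estimate on the `k`-th shell along the short times. The shell `k = 0` is a ball
rather than an annulus, and there the estimate is only local. -/
theorem IsLocalBound.exists_short_time (hC : IsLocalBound d α s C) (hs : 0 ≤ s) (hα : 0 < α)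
    (t : ℕ → ℝ) :
    ∃ C₀ : ℝ≥0, ∀ (k : ℕ) (g : L2Rd d),
      ∫⁻ x in ball 0 1, (⨆ n ∈ shortTimes α t k,
        ‖evol α (t n) (shellPart k g) x‖ₑ) ^ 2 ≤ C₀ * ∫⁻ ξ, ‖shellPart k g ξ‖ₑ ^ 2 := by
  obtain ⟨C₁, h₁⟩ := hC.exists_lowFrequency
  obtain ⟨C₂, h₂⟩ := hC.exists_shell hs hα
  refine ⟨C₁ + C₂, fun k g => ?_⟩
  rw [ENNReal.coe_add, add_mul]
  cases k with
  | zero =>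
    refine le_add_right (h₁ _ t _ ?_ fun n hn => by simpa [shortTimes] using hn)
    filter_upwards [shellPart_support 0 g] with ξ hξ h0
    have := (hξ h0).2
    simp only [dyadicRadius, pow_zero] at this
    exact this.le
  | succ k =>
    refine le_add_left ((setLIntegral_le_lintegral _ _).trans ?_)
    have := h₂ (2 ^ (k + 1)) 1 (shellPart (k + 1) g) t
      (shortTimes α t (k + 1)) (by positivity) le_rfl ?_ ?_
    · simpa using this
    · filter_upwards [shellPart_support (k + 1) g] with ξ hξ h0
      obtain ⟨h1, h2⟩ := hξ h0
      simp only [dyadicRadius] at h1 h2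
      refine ⟨?_, h2.le⟩
      rw [pow_succ, mul_div_cancel_right₀ _ two_ne_zero]; exact h1
    · intro n hn
      rw [one_mul, two_pow_rpow_inv]
      exact hn

/-- The maximal estimate on the `k`-th shell along the long times below `2 ^ (-(k + i) q)`. The
shell bound with `T = 2 ^ (k α - (k + i) q)` loses `T ^ (2 s / min α 1)`, which by the choice of `q`
is the Sobolev factor `2 ^ (2 k σ)` times a geometric gain in `i`. -/
theorem IsLocalBound.exists_long_time (hC : IsLocalBound d α s C) (hs : 0 ≤ s) (hα : 0 < α)
    {q σ : ℝ} (hq : 0 ≤ q) (hσ : s / min α 1 * (α - q) = σ) (t : ℕ → ℝ) :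
    ∃ C₁ : ℝ≥0, ∀ (k i : ℕ) (g : L2Rd d),
      ∫⁻ x in ball 0 1,
        (⨆ n ∈ longTimes α q t k i,
          ‖evol α (t n) (shellPart k g) x‖ₑ) ^ 2 ≤
        C₁ * ((2 : ℝ≥0∞) ^ (2 * k * σ : ℝ) * 2 ^ (-(2 * i * (q * (s / min α 1))) : ℝ)) *
          ∫⁻ ξ, ‖shellPart k g ξ‖ₑ ^ 2 := by
  obtain ⟨C₂, h₂⟩ := hC.exists_shell hs hα
  refine ⟨C₂, fun k i g => ?_⟩
  set S := longTimes α q t k i with hS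
  rcases S.eq_empty_or_nonempty with hE | ⟨m, hm⟩
  · simp [hE]
  have hlt : (k + i : ℕ) * q < k * α := by
    have := (Real.rpow_lt_rpow_left_iff one_lt_two).1 (hm.1.trans hm.2)
    linarith
  -- there are no long times at `k = 0`, as `q ≥ 0`
  cases k with
  | zero =>
    exfalso
    have : 0 ≤ ((0 + i : ℕ) : ℝ) * q := by positivity
    simp only [Nat.cast_zero, zero_mul] at hlt
    linarith
  | succ k =>
    refine (setLIntegral_le_lintegral _ _).trans ?_
    set T : ℝ := 2 ^ ((k + 1 : ℕ) * α - ((k + 1 + i : ℕ) * q) : ℝ) with hT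
    have := h₂ (2 ^ (k + 1)) T (shellPart (k + 1) g) t S (by positivity)
      (Real.one_le_rpow one_le_two (by linarith)) ?_ ?_
    · refine this.trans (le_of_eq ?_)
      congr 2
      rw [hT, ← Real.rpow_mul (by norm_num), ← ENNReal.rpow_add _ _ two_ne_zero (by norm_num),
        ← ENNReal.ofReal_rpow_of_pos two_pos, ENNReal.ofReal_ofNat]
      congr 1
      rw [← hσ]; push_cast; ring
    · filter_upwards [shellPart_support (k + 1) g] with ξ hξ h0
      obtain ⟨h1, h2⟩ := hξ h0
      simp only [dyadicRadius] at h1 h2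
      refine ⟨?_, h2.le⟩
      rw [pow_succ, mul_div_cancel_right₀ _ two_ne_zero]; exact h1
    · intro n hn
      refine ⟨fun h0 => ?_, ?_⟩
      · have := hn.1
        rw [h0, abs_zero] at this
        exact absurd this (not_lt_of_gt (by positivity))
      · rw [two_pow_rpow_inv, hT, ← Real.rpow_add two_pos]
        refine hn.2.le.trans (le_of_eq ?_)
        congr 1; ring

theorem ENNReal.le_two_rpow_neg_mul_sqrt {u : ℝ} {F Q : ℝ≥0∞}
    (h : (2 : ℝ≥0∞) ^ (2 * u) * F ^ 2 ≤ Q) :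
    F ≤ 2 ^ (-u) * Q ^ (1 / 2 : ℝ) := by
  have h1 : (2 : ℝ≥0∞) ^ u * F ≤ Q ^ (1 / 2 : ℝ) := by
    rw [one_div, ENNReal.le_rpow_inv_iff two_pos, ENNReal.rpow_two, mul_pow, ← ENNReal.rpow_two,
      ← ENNReal.rpow_mul, mul_comm u 2]
    exact h
  calc F = 2 ^ (-u) * (2 ^ u * F) := by
        rw [← mul_assoc, ← ENNReal.rpow_add _ _ two_ne_zero (by norm_num), neg_add_cancel,
          ENNReal.rpow_zero, one_mul]
    _ ≤ _ := mul_le_mul_right h1 _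

theorem two_rpow_neg_pow (u : ℝ) (k : ℕ) : (2 : ℝ≥0∞) ^ (-(k * u) : ℝ) = (2 ^ (-u)) ^ k := by
  rw [← ENNReal.rpow_natCast, ← ENNReal.rpow_mul]
  congr 1; ring

theorem two_rpow_neg_lt_one {u : ℝ} (hu : 0 < u) : (2 : ℝ≥0∞) ^ (-u) < 1 :=
  ENNReal.rpow_lt_one_of_one_lt_of_neg (by norm_num) (by linarith)

theorem sum_range_geometric_le (θ₀ θ₁ a b : ℝ≥0∞) (N : ℕ) {e : ℕ → ℝ≥0∞}
    (he : ∀ k < N, e k ≤ θ₀ ^ k * a + θ₁ ^ (N - 1 - k) * b) :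
    ∑ k ∈ Finset.range N, e k ≤ (1 - θ₀)⁻¹ * a + (1 - θ₁)⁻¹ * b := by
  calc _ ≤ ∑ k ∈ Finset.range N, (θ₀ ^ k * a + θ₁ ^ (N - 1 - k) * b) :=
        Finset.sum_le_sum fun k hk => he k (Finset.mem_range.1 hk)
    _ = (∑ k ∈ Finset.range N, θ₀ ^ k) * a + (∑ k ∈ Finset.range N, θ₁ ^ k) * b := by
        rw [Finset.sum_add_distrib, ← Finset.sum_mul, ← Finset.sum_mul,
          Finset.sum_range_reflect (fun k => θ₁ ^ k)]
    _ ≤ _ := by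
        rw [← ENNReal.tsum_geometric, ← ENNReal.tsum_geometric]
        exact add_le_add (mul_le_mul_left (ENNReal.sum_le_tsum _) _)
          (mul_le_mul_left (ENNReal.sum_le_tsum _) _)

/-- The number of shells to be treated by maximal estimates at time `τ`: the first `N` with
`2 ^ (-N q) ≤ |τ|`. -/
theorem exists_numShells {q τ : ℝ} (hq : 0 < q) (hτ : τ ≠ 0) :
    ∃ N : ℕ, (2 : ℝ) ^ (-(N * q) : ℝ) ≤ |τ| ∧ ∀ k < N, |τ| < (2 : ℝ) ^ (-(k * q) : ℝ) := by
  classical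
  have hex : ∃ N : ℕ, (2 : ℝ) ^ (-(N * q) : ℝ) ≤ |τ| := by
    obtain ⟨N, hN⟩ := exists_pow_lt_of_lt_one (abs_pos.2 hτ)
      (Real.rpow_lt_one_of_one_lt_of_neg one_lt_two (by linarith : -q < 0))
    refine ⟨N, le_trans (le_of_eq ?_) hN.le⟩
    rw [← Real.rpow_natCast, ← Real.rpow_mul (by norm_num)]
    congr 1; ring
  exact ⟨Nat.find hex, Nat.find_spec hex, fun k hk => not_le.1 (Nat.find_min hex hk)⟩

theorem lintegral_sq_le_weighted {σ : ℝ} (hσ : 0 ≤ σ) (g : L2Rd d) :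
    ∫⁻ ξ, ‖g ξ‖ₑ ^ 2 ≤ ∫⁻ ξ, ENNReal.ofReal (sobolevWeight σ ξ) * ‖g ξ‖ₑ ^ 2 := by
  refine lintegral_mono fun ξ => ?_
  refine (one_mul _).symm.le.trans (mul_le_mul_left ?_ _)
  rw [← ENNReal.ofReal_one]
  exact ENNReal.ofReal_le_ofReal
    (Real.one_le_rpow (by nlinarith [sq_nonneg (2 * Real.pi * ‖ξ‖)]) hσ)

/-- The sequential estimate at regularity `σ`, for exponents balanced so that the long times on the
shells below the threshold `|t n| ≈ 2 ^ (-N q)` (`hσ`) and the frequency tails above it (`hqr`)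
both cost exactly `σ` derivatives. -/
theorem IsLocalBound.exists_sequential_aux (hC : IsLocalBound d α s C) (hs : 0 ≤ s) (hα : 0 < α)
    {q σ r : ℝ} (hq : 0 < q) (hσ0 : 0 < σ) (ha : 0 < s / min α 1)
    (hσ : s / min α 1 * (α - q) = σ) (hqr : q * r = 2 * σ) (ht : MemWeakEll r t) :
    ∃ D : ℝ≥0, ∀ g : L2Rd d, ∫⁻ x in ball 0 1, (⨆ n, ‖evol α (t n) g x‖ₑ) ^ 2 ≤
      D * ∫⁻ ξ, ENNReal.ofReal (sobolevWeight σ ξ) * ‖g ξ‖ₑ ^ 2 := by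
  set a := s / min α 1 with ha_def
  obtain ⟨K, hK⟩ := ht.exists_encard_le
  obtain ⟨C₀, hC₀⟩ := hC.exists_short_time hs hα t
  obtain ⟨C₁, hC₁⟩ := hC.exists_long_time hs hα hq.le hσ t
  rw [← ha_def] at hC₁
  have hex : ∀ n, ∃ N : ℕ, t n ≠ 0 → (2 : ℝ) ^ (-(N * q) : ℝ) ≤ |t n| ∧
      ∀ k < N, |t n| < (2 : ℝ) ^ (-(k * q) : ℝ) := by
    intro n
    by_cases h : t n = 0
    -- the zero times are covered by `evol α 0 g`, the value of `N` there is irrelevant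
    · exact ⟨0, fun h' => absurd h h'⟩
    · obtain ⟨N, hN⟩ := exists_numShells hq h
      exact ⟨N, fun _ => hN⟩
  choose N hN using hex
  -- Each maximal function is weighted so that its square is summable, and bounded by the square
  -- root of that sum times a geometric factor: ratio `θ₀` in `k` for the short times, `θ₁` in `i`
  -- for the long times. Half of the geometric gain in `i` is left for the sum of the integrals,
  -- which is `D₂`.
  set θ₀ : ℝ≥0∞ := 2 ^ (-σ) with hθ₀
  set θ₁ : ℝ≥0∞ := 2 ^ (-(q * a / 2)) with hθ₁
  set D₀ : ℝ≥0∞ := (1 - θ₀)⁻¹ with hD₀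
  set D₁ : ℝ≥0∞ := (1 - θ₁)⁻¹ with hD₁
  set D₂ : ℝ≥0∞ := (1 - (2 : ℝ≥0∞) ^ (-(q * a)))⁻¹ with hD₂
  have hgeo : ∀ u : ℝ, 0 < u → (1 - (2 : ℝ≥0∞) ^ (-u))⁻¹ ≠ ∞ := fun u hu =>
    ENNReal.inv_ne_top.2 (tsub_pos_of_lt (two_rpow_neg_lt_one hu)).ne'
  set Dtot : ℝ≥0∞ := 4 * (D₀ ^ 2 * C₀ + D₁ ^ 2 * (C₁ * D₂) + K + 1) with hDtot
  have hD₀t : D₀ ≠ ∞ := hgeo σ hσ0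
  have hD₁t : D₁ ≠ ∞ := hgeo _ (by positivity)
  have hD₂t : D₂ ≠ ∞ := hgeo _ (by positivity)
  have hDt : Dtot ≠ ∞ := by
    rw [hDtot]; finiteness
  refine ⟨Dtot.toNNReal, fun g => ?_⟩
  rw [ENNReal.coe_toNNReal hDt]
  set E : ℝ≥0∞ := ∫⁻ ξ, ENNReal.ofReal (sobolevWeight σ ξ) * ‖g ξ‖ₑ ^ 2 with hE
  set F₀ : ℕ → Rd d → ℝ≥0∞ := fun k x => ⨆ n ∈ shortTimes α t k,
    ‖evol α (t n) (shellPart k g) x‖ₑ with hF₀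
  set F₁ : ℕ → ℕ → Rd d → ℝ≥0∞ := fun k i x =>
    ⨆ n ∈ longTimes α q t k i,
      ‖evol α (t n) (shellPart k g) x‖ₑ with hF₁
  have hF₀m : ∀ k, Measurable (F₀ k) := fun k => measurable_iSup_evol _ _ _ _
  have hF₁m : ∀ k i, Measurable (F₁ k i) := fun k i => measurable_iSup_evol _ _ _ _
  set Q₀ : Rd d → ℝ≥0∞ := fun x => ∑' k : ℕ, (2 : ℝ≥0∞) ^ (2 * (k * σ) : ℝ) * F₀ k x ^ 2 with hQ₀
  set Q₁ : Rd d → ℝ≥0∞ := fun x => ∑' k : ℕ, ∑' i : ℕ,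
    (2 : ℝ≥0∞) ^ (2 * (i * (q * a / 2)) : ℝ) * F₁ k i x ^ 2 with hQ₁
  set tail : ℕ → L2Rd d := fun n =>
    freqCut (freqTail d (N n)) (measurableSet_freqTail d (N n)) g with htail
  set S : Set ℕ := {n | t n ≠ 0} with hS
  set Q₂ : Rd d → ℝ≥0∞ := fun x => ∑' n : S, ‖evol α (t n) (tail n) x‖ₑ ^ 2 with hQ₂
  have hev : ∀ (τ : ℝ) (u : L2Rd d), Measurable fun x => ‖evol α τ u x‖ₑ ^ 2 := fun τ u =>
    (Lp.stronglyMeasurable _).measurable.enorm.pow_const 2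
  have hQ₀m : Measurable Q₀ :=
    Measurable.tsum fun k => ((hF₀m k).pow_const 2).const_mul _
  have hQ₁m : Measurable Q₁ := Measurable.tsum fun k => Measurable.tsum fun i =>
    ((hF₁m k i).pow_const 2).const_mul _
  have hQ₂m : Measurable Q₂ := Measurable.tsum fun n => hev _ _
  -- the pointwise bound
  have hpt : ∀ᵐ x, (⨆ n, ‖evol α (t n) g x‖ₑ) ^ 2 ≤
      4 * (D₀ ^ 2 * Q₀ x + D₁ ^ 2 * Q₁ x + Q₂ x + ‖evol α 0 g x‖ₑ ^ 2) := by
    filter_upwards [ae_all_iff.2 fun n => evol_ae_eq_sum_shells (α := α) (t n) g (N n)] with x hx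
    have hroot : ∀ c : ℝ≥0∞, (c ^ (1 / 2 : ℝ)) ^ 2 = c := fun c => by
      rw [← ENNReal.rpow_two, ← ENNReal.rpow_mul]; norm_num
    have hsup : (⨆ n, ‖evol α (t n) g x‖ₑ) ≤ (D₀ * Q₀ x ^ (1 / 2 : ℝ) + D₁ * Q₁ x ^ (1 / 2 : ℝ)) +
        (Q₂ x ^ (1 / 2 : ℝ) + ‖evol α 0 g x‖ₑ) := by
      refine iSup_le fun n => ?_
      by_cases h0 : t n = 0
      · rw [h0]; exact le_add_left (le_add_left le_rfl)
      obtain ⟨hN1, hN2⟩ := hN n h0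
      rw [hx n]
      refine (enorm_add_le _ _).trans (add_le_add ?_ (le_add_right ?_))
      · refine (enorm_sum_le _ _).trans (sum_range_geometric_le θ₀ θ₁ _ _ (N n) fun k hk => ?_)
        rcases le_or_gt |t n| (2 ^ (-(k * α) : ℝ)) with h | h
        · refine le_add_right ?_
          have h1 : ‖evol α (t n) (shellPart k g) x‖ₑ ≤ F₀ k x :=
            enorm_evol_le_iSup (S := shortTimes α t k) ⟨h0, h⟩ _ x
          refine h1.trans ?_
          rw [hθ₀, ← two_rpow_neg_pow]
          exact ENNReal.le_two_rpow_neg_mul_sqrt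
            (ENNReal.le_tsum (f := fun k : ℕ => (2 : ℝ≥0∞) ^ (2 * (k * σ) : ℝ) * F₀ k x ^ 2) k)
        · refine le_add_left ?_
          have hki : k + (N n - 1 - k) = N n - 1 := by omega
          have h1 : ‖evol α (t n) (shellPart k g) x‖ₑ ≤ F₁ k (N n - 1 - k) x :=
            enorm_evol_le_iSup (S := longTimes α q t k (N n - 1 - k))
              ⟨h, by rw [hki]; exact hN2 _ (by omega)⟩ _ x
          refine h1.trans ?_
          rw [hθ₁, ← two_rpow_neg_pow]
          refine ENNReal.le_two_rpow_neg_mul_sqrt (le_trans ?_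
            (ENNReal.le_tsum (f := fun k : ℕ => ∑' i : ℕ,
              (2 : ℝ≥0∞) ^ (2 * (i * (q * a / 2)) : ℝ) * F₁ k i x ^ 2) k))
          exact ENNReal.le_tsum (f := fun i : ℕ =>
            (2 : ℝ≥0∞) ^ (2 * (i * (q * a / 2)) : ℝ) * F₁ k i x ^ 2) (N n - 1 - k)
      · rw [one_div, ENNReal.le_rpow_inv_iff two_pos, ENNReal.rpow_two]
        exact ENNReal.le_tsum (f := fun n : S => ‖evol α (t n) (tail n) x‖ₑ ^ 2) ⟨n, h0⟩
    calc _ ≤ _ := pow_le_pow_left' hsup 2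
      _ ≤ 2 * (2 * ((D₀ * Q₀ x ^ (1 / 2 : ℝ)) ^ 2 + (D₁ * Q₁ x ^ (1 / 2 : ℝ)) ^ 2) +
          2 * ((Q₂ x ^ (1 / 2 : ℝ)) ^ 2 + ‖evol α 0 g x‖ₑ ^ 2)) :=
        (ENNReal.add_sq_le_two_mul _ _).trans (mul_le_mul_right (add_le_add
          (ENNReal.add_sq_le_two_mul _ _) (ENNReal.add_sq_le_two_mul _ _)) _)
      _ = _ := by rw [mul_pow, mul_pow, hroot, hroot, hroot]; ring
  -- the integrals of the four terms
  have hshell := tsum_shell_energy_le hσ0.le g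
  have hI₀ : ∫⁻ x in ball 0 1, Q₀ x ≤ C₀ * E := by
    rw [hQ₀, lintegral_tsum fun k => (((hF₀m k).pow_const 2).const_mul _).aemeasurable]
    refine le_trans ?_ (mul_le_mul_right hshell _)
    rw [← ENNReal.tsum_mul_left]
    refine ENNReal.tsum_le_tsum fun k => ?_
    rw [lintegral_const_mul' _ _ (by simp), ← mul_assoc 2 (k : ℝ) σ]
    refine (mul_le_mul_right (hC₀ k g) _).trans (le_of_eq ?_)
    rw [shellPart]; ring
  have hI₁ : ∫⁻ x in ball 0 1, Q₁ x ≤ C₁ * D₂ * E := by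
    rw [hQ₁, lintegral_tsum fun k => (Measurable.tsum fun i =>
      ((hF₁m k i).pow_const 2).const_mul _).aemeasurable]
    refine le_trans ?_ (mul_le_mul_right hshell _)
    rw [← ENNReal.tsum_mul_left]
    refine ENNReal.tsum_le_tsum fun k => ?_
    rw [lintegral_tsum fun i => (((hF₁m k i).pow_const 2).const_mul _).aemeasurable]
    calc _ ≤ ∑' i : ℕ, ((2 : ℝ≥0∞) ^ (-(q * a))) ^ i * (C₁ * ((2 : ℝ≥0∞) ^ (2 * k * σ : ℝ) *
          ∫⁻ ξ, ‖shellPart k g ξ‖ₑ ^ 2)) := by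
          refine ENNReal.tsum_le_tsum fun i => ?_
          rw [lintegral_const_mul' _ _ (by simp), ← two_rpow_neg_pow]
          refine (mul_le_mul_right (hC₁ k i g) _).trans (le_of_eq ?_)
          have : (2 : ℝ≥0∞) ^ (-(i * (q * a)) : ℝ) = 2 ^ (2 * (i * (q * a / 2)) : ℝ) *
              2 ^ (-(2 * i * (q * a)) : ℝ) := by
            rw [← ENNReal.rpow_add _ _ two_ne_zero (by norm_num)]
            congr 1; ring
          rw [this]; ring
      _ = _ := by
          rw [ENNReal.tsum_mul_right, ENNReal.tsum_geometric, shellPart]; ring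
  have hI₂ : ∫⁻ x in ball 0 1, Q₂ x ≤ K * E := by
    rw [hQ₂, lintegral_tsum fun n => (hev _ _).aemeasurable]
    refine le_trans (ENNReal.tsum_le_tsum fun n => ?_) (tsum_tail_energy_le hq.le hqr hK
      (S := S) (N := N) (fun n hn => (hN n hn).1) g)
    refine (setLIntegral_le_lintegral _ _).trans (le_of_eq ?_)
    rw [lintegral_enorm_evol_sq]
  have hI₃ : ∫⁻ x in ball 0 1, ‖evol α 0 g x‖ₑ ^ 2 ≤ E := by
    refine (setLIntegral_le_lintegral _ _).trans ?_
    rw [lintegral_enorm_evol_sq]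
    exact lintegral_sq_le_weighted hσ0.le g
  calc _ ≤ ∫⁻ x in ball 0 1, 4 * (D₀ ^ 2 * Q₀ x + D₁ ^ 2 * Q₁ x + Q₂ x + ‖evol α 0 g x‖ₑ ^ 2) :=
        lintegral_mono_ae (ae_restrict_of_ae hpt)
    _ = 4 * (D₀ ^ 2 * (∫⁻ x in ball 0 1, Q₀ x) + D₁ ^ 2 * (∫⁻ x in ball 0 1, Q₁ x) +
          (∫⁻ x in ball 0 1, Q₂ x) + ∫⁻ x in ball 0 1, ‖evol α 0 g x‖ₑ ^ 2) := by
        rw [lintegral_const_mul' _ _ (by norm_num), lintegral_add_left (by fun_prop),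
          lintegral_add_left (by fun_prop), lintegral_add_left (by fun_prop),
          lintegral_const_mul' _ _ (by finiteness), lintegral_const_mul' _ _ (by finiteness)]
    _ ≤ 4 * (D₀ ^ 2 * (C₀ * E) + D₁ ^ 2 * (C₁ * D₂ * E) + K * E + E) := by gcongr
    _ = _ := by rw [hDtot]; ring

end Sequential

/-! ### The sequential maximal estimate -/

section Conclusion
variable {d : ℕ} {α s r : ℝ} {C : ℝ≥0} {t : ℕ → ℝ}

/-- The sequential estimate at the critical regularity `σ = r α s / (r min α 1 + 2 s)`. The value
`q = 2 σ / r` is the solution of the two balance conditions. -/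
theorem IsLocalBound.exists_sequential (hC : IsLocalBound d α s C) (hs : 0 < s) (hα : 0 < α)
    (hr : 0 < r) (ht : MemWeakEll r t) :
    ∃ D : ℝ≥0, ∀ g : L2Rd d, ∫⁻ x in ball 0 1, (⨆ n, ‖evol α (t n) g x‖ₑ) ^ 2 ≤
      D * ∫⁻ ξ, ENNReal.ofReal (sobolevWeight (r * α / (r * min α 1 + 2 * s) * s) ξ) *
        ‖g ξ‖ₑ ^ 2 := by
  have hm : 0 < min α 1 := lt_min hα one_pos
  have hden : 0 < r * min α 1 + 2 * s := by positivity
  refine hC.exists_sequential_aux hs.le hα (q := 2 * (r * α / (r * min α 1 + 2 * s) * s) / r)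
    (by positivity) (by positivity) (by positivity) ?_ (by field_simp) ht
  field_simp
  ring

/-- At the regularity `s` of the hypothesis it suffices that all but finitely many times satisfy
`|t n| ≤ 1`. -/
theorem IsLocalBound.exists_sequential_self (hC : IsLocalBound d α s C) (hs : 0 ≤ s)
    (ht : MemWeakEll r t) :
    ∃ D : ℝ≥0, ∀ g : L2Rd d, ∫⁻ x in ball 0 1, (⨆ n, ‖evol α (t n) g x‖ₑ) ^ 2 ≤
      D * ∫⁻ ξ, ENNReal.ofReal (sobolevWeight s ξ) * ‖g ξ‖ₑ ^ 2 := by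
  obtain ⟨K, hK⟩ := ht.exists_encard_le
  have hK1 := hK 1 one_pos
  rw [Real.one_rpow, ENNReal.ofReal_one, mul_one] at hK1
  refine ⟨C + 1 + K, fun g => ?_⟩
  set E : ℝ≥0∞ := ∫⁻ ξ, ENNReal.ofReal (sobolevWeight s ξ) * ‖g ξ‖ₑ ^ 2 with hE
  by_cases hfin : E = ∞
  · rw [hfin, ENNReal.mul_top (by positivity)]
    exact le_top
  have hev : ∀ τ : ℝ, Measurable fun x => ‖evol α τ g x‖ₑ ^ 2 := fun τ =>
    (Lp.stronglyMeasurable _).measurable.enorm.pow_const 2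
  have hgE : ∀ τ : ℝ, ∫⁻ x in ball 0 1, ‖evol α τ g x‖ₑ ^ 2 ≤ E := fun τ =>
    (setLIntegral_le_lintegral _ _).trans
      ((lintegral_enorm_evol_sq g).le.trans (lintegral_sq_le_weighted hs g))
  set F : Rd d → ℝ≥0∞ := fun x => ⨆ n ∈ {n | t n ≠ 0 ∧ |t n| ≤ 1}, ‖evol α (t n) g x‖ₑ with hF
  have hFm : Measurable F := measurable_iSup_evol _ _ _ _
  set S : Set ℕ := {n | 1 ≤ |t n|} with hS
  set Q : Rd d → ℝ≥0∞ := fun x => ∑' n : S, ‖evol α (t n) g x‖ₑ ^ 2 with hQ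
  have hpt : ∀ x, (⨆ n, ‖evol α (t n) g x‖ₑ) ^ 2 ≤ F x ^ 2 + ‖evol α 0 g x‖ₑ ^ 2 + Q x := by
    intro x
    rw [ENNReal.iSup_pow]
    refine iSup_le fun n => ?_
    by_cases h0 : t n = 0
    · rw [h0]; exact le_add_right (le_add_left le_rfl)
    rcases le_total |t n| 1 with h | h
    · refine le_add_right (le_add_right (pow_le_pow_left' ?_ 2))
      exact enorm_evol_le_iSup (S := {n | t n ≠ 0 ∧ |t n| ≤ 1}) ⟨h0, h⟩ g x
    · exact le_add_left (ENNReal.le_tsum (f := fun n : S => ‖evol α (t n) g x‖ₑ ^ 2) ⟨n, h⟩)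
  have hQI : ∫⁻ x in ball 0 1, Q x ≤ K * E := by
    rw [hQ, lintegral_tsum fun n => (hev _).aemeasurable]
    calc _ ≤ ∑' _ : S, E := ENNReal.tsum_le_tsum fun n => hgE _
      _ = (S.encard : ℝ≥0∞) * E := by rw [ENNReal.tsum_set_const]
      _ ≤ _ := mul_le_mul_left hK1 _
  calc _ ≤ ∫⁻ x in ball 0 1, (F x ^ 2 + ‖evol α 0 g x‖ₑ ^ 2 + Q x) := lintegral_mono hpt
    _ = (∫⁻ x in ball 0 1, F x ^ 2) + (∫⁻ x in ball 0 1, ‖evol α 0 g x‖ₑ ^ 2) +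
          ∫⁻ x in ball 0 1, Q x := by
        have := hev 0
        rw [lintegral_add_left (by fun_prop), lintegral_add_left (by fun_prop)]
    _ ≤ C * E + E + K * E :=
        add_le_add (add_le_add (hC.lintegral_iSup_le hs g hfin t _ fun n hn => hn) (hgE 0)) hQI
    _ = _ := by push_cast; ring

theorem sobolevWeight_mono {σ : ℝ} (h : σ ≤ s) (ξ : Rd d) :
    sobolevWeight σ ξ ≤ sobolevWeight s ξ :=
  Real.rpow_le_rpow_of_exponent_le (by nlinarith [sq_nonneg (2 * Real.pi * ‖ξ‖)]) h

theorem sequentialMaximalEstimate_of_lintegral {σ : ℝ} (hσ : σ ≤ s) {D : ℝ≥0}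
    (h : ∀ g : L2Rd d, ∫⁻ x in ball 0 1, (⨆ n, ‖evol α (t n) g x‖ₑ) ^ 2 ≤
      D * ∫⁻ ξ, ENNReal.ofReal (sobolevWeight σ ξ) * ‖g ξ‖ₑ ^ 2) :
    SequentialMaximalEstimate d α t s := by
  -- the squared Sobolev norm is `(2π)^d` times the weighted integral
  have hone : (1 : ℝ) ≤ (2 * Real.pi) ^ d := one_le_pow₀ (by linarith [Real.pi_gt_three])
  refine ⟨NNReal.sqrt D, fun f _ => ?_⟩
  rw [← ENNReal.pow_le_pow_left_iff two_ne_zero, eLpNorm_two_sq, mul_pow, sobolevENorm_sq,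
    ← ENNReal.coe_pow, NNReal.sq_sqrt]
  simp only [enorm_eq_self, schrodingerOp_eq_evol]
  refine (h (𝓕 f)).trans (mul_le_mul_right ?_ _)
  calc _ ≤ ∫⁻ η, ENNReal.ofReal (sobolevWeight s η) * ‖(𝓕 f : L2Rd d) η‖ₑ ^ 2 :=
        lintegral_mono fun ξ =>
          mul_le_mul_left (ENNReal.ofReal_le_ofReal (sobolevWeight_mono hσ ξ)) _
    _ ≤ _ := by
        refine (one_mul _).symm.le.trans (mul_le_mul_left ?_ _)
        rw [← ENNReal.ofReal_one]
        exact ENNReal.ofReal_le_ofReal hone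

end Conclusion

end

theorem theorem1p1 (d : ℕ) (hd : 1 ≤ d) (α sStar r : ℝ) (hα : 0 < α) (hsStar : 0 < sStar)
    (hr : 0 < r)
    (hmax : ∀ s : ℝ, sStar ≤ s → LocalMaximalEstimate d α s)
    (t : ℕ → ℝ) (ht : MemWeakEll r t)
    (s : ℝ) (hs : min (r * α / (r * min α 1 + 2 * sStar) * sStar) sStar ≤ s) :
    SequentialMaximalEstimate d α t s := by
  obtain ⟨C, hC⟩ := (hmax sStar le_rfl).lintegral_le
  have hC : IsLocalBound d α sStar C := hC
  rcases min_le_iff.1 hs with h | h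
  · obtain ⟨D, hD⟩ := hC.exists_sequential hsStar hα hr ht
    exact sequentialMaximalEstimate_of_lintegral h hD
  · obtain ⟨D, hD⟩ := hC.exists_sequential_self hsStar.le ht
    exact sequentialMaximalEstimate_of_lintegral h hD
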